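/- Let $n\ge 0$, $N\ge 1$, $[N]=\{1,\dots,N\}$, and let $f_i,h_i,g:\mathbb R^n\to\mathbb R\cup\{\infty\}$, $i\in[N]$, and $L_{f_i}\ge 0$, $\gamma_i>0$ with $\gamma_iL_{f_i}<N$. Put $$\varphi=\tfrac1N\sum_{i=1}^N f_i+g,\qquad C=\bigcap_{i=1}^N\operatorname{int}\operatorname{dom}h_i,\qquad T(s)=\operatorname*{argmin}_{w\in\mathbb R^n}\Big\{g(w)+\sum_{i=1}^N\tfrac1{\gamma_i}h_i(w)-\langle s,w\rangle\Big\}.$$ A Legendre kernel is a proper, lsc, strictly convex function $h$ that is $C^1$ on $\operatorname{int}\operatorname{dom}h\ne\emptyset$, is 1-coercive ($h(x)/\|x\|\to\infty$ as $\|x\|\to\infty$) and essentially smooth ($\|\nabla h(x_k)\|\to\infty$ whenever $\operatorname{int}\operatorname{dom}h\ni x_k\to x\in\partial\operatorname{dom}h$). A proper lsc function $f$ is $L$-smooth relative to $h$ if $L\ge0$, $\operatorname{dom}f\supseteq\operatorname{dom}h$ and $Lh\pm f$ are convex on $\operatorname{int}\operatorname{dom}h$. The regular subdifferential $\hat\partial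 q(\bar x)$ of $q$ at a point $\bar x$ where $q$ is finite is the set of $v$ with $\liminf_{\bar x\ne x\to\bar x}\frac{q(x)-q(\bar x)-\langle v,x-\bar x\rangle}{\|x-\bar x\|}\ge0$; the limiting subdifferential $\partial q(x)$, $x\in\operatorname{dom}q$, is the set of limits of $v^k\in\hat\partial q(x^k)$ with $x^k\to x$, $q(x^k)\to q(x)$. A point $x$ is stationary for $q$ if $0\in\hat\partial q(x)$. A proper lsc function $q$ has the KL property with exponent $\theta\in(0,1)$ if for every $\bar w$ with $\partial q(\bar w)\neq\emptyset$ there are $\varepsilon,\eta,\varrho>0$ such that $\varrho(1-\theta)\,(q(w)-q(\bar w))^{-\theta}\operatorname{dist}(0,\partial q(w))\ge1$ whenever $\|w-\bar w\|<\varepsilon$ and $q(\bar w)<q(w)<q(\bar w)+\eta$ (with $\operatorname{dist}(0,\emptyset)=\infty$). **Basic assumption.** Each $h_i$ is a Legendre kernel and $f_i$ is $L_{f_i}$-smooth relative to $h_i$; $g$ is proper and lsc; $\varphi$ attains its minimum over $\overline C$; and $T(s)\subseteq C$ for all $s\in\mathbb R^n$. **KL assumption.** $f_i,h_i\in C^2(\mathbb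 R^n)$ (hence $C=\mathbb R^n$) with $\nabla^2h_i\succ0$ everywhere, $i\in[N]$; $\varphi$ is level bounded and has the KL property with exponent $\theta\in(0,1)$. **Low-memory algorithm.** Write $S_i(x)=\tfrac1{\gamma_i}\nabla h_i(x)-\tfrac1N\nabla f_i(x)$. Given $x^{\rm init}\in C$, start from $\tilde s^0=\sum_{i=1}^NS_i(x^{\rm init})$ and $\mathcal K^0=\emptyset$. For $k=0,1,2,\dots$ choose any $z^k\in T(\tilde s^k)$. If $\mathcal K^k=\emptyset$, set $\mathcal I^{k+1}=\mathcal K^{k+1}=[N]$, $\tilde z^k=z^k$ and $\tilde s^{k+1}=\sum_{i=1}^NS_i(z^k)$. Otherwise choose any nonempty $\mathcal I^{k+1}\subseteq\mathcal K^k$ and set $\mathcal K^{k+1}=\mathcal K^k\setminus\mathcal I^{k+1}$, $\tilde z^k=\tilde z^{k-1}$ and $\tilde s^{k+1}=\tilde s^k+\sum_{i\in\mathcal I^{k+1}}\big(S_i(z^k)-S_i(\tilde z^k)\big)$. **Theorem.** Suppose that the basic assumption and the KL assumption hold (no convexity of $g$ or of the $f_i$ is required). Then for any sequences generated by the low-memory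 algorithm: 1. $(\tilde z^k)_{k}$ converges to a stationary point $x^\star$ of $\varphi$. 2. If $\theta>\tfrac12$, there exists $c>0$ such that $\varphi(\tilde z^k)-\varphi(x^\star)\le c\,k^{-\frac1{2\theta-1}}$ for all $k\ge1$. 3. If $\theta\in(0,\tfrac12]$, then $(\tilde z^k)$ and $(\varphi(\tilde z^k))$ converge at $R$-linear rate to $x^\star$ and $\varphi(x^\star)$, respectively, i.e. there are $c\in(0,1)$ and $\rho>0$ with $\|\tilde z^k-x^\star\|\le\rho c^k$ for all $k\ge0$, and likewise there are such constants with $\varphi(\tilde z^k)\in\mathbb R$ and $|\varphi(\tilde z^k)-\varphi(x^\star)|\le\rho c^k$ for all $k\ge0$. -/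

import Mathlib

open Filter Topology
open scoped InnerProductSpace

noncomputable section

namespace BregmanFinito

/-- The Euclidean space `ℝⁿ`. -/
abbrev E (n : ℕ) : Type := EuclideanSpace ℝ (Fin n)

variable {n N : ℕ}

/-! ### Extended-real-valued functions `ℝⁿ → ℝ ∪ {∞}` -/

/-- The (effective) domain `{x | q x < ∞}`. -/
def dom (q : E n → EReal) : Set (E n) := {x | q x < ⊤}

/-- The real-valued representative of `q`; it agrees with `q` wherever `q` is finite. -/
def re (q : E n → EReal) : E n → ℝ := fun x => (q x).toReal

/-- `q` takes values in `ℝ ∪ {∞}` and is not identically `∞`. -/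
def IsProper (q : E n → EReal) : Prop := (∀ x, q x ≠ ⊥) ∧ (dom q).Nonempty

/-- All sublevel sets are bounded. -/
def LevelBounded (q : E n → EReal) : Prop :=
  ∀ α : ℝ, Bornology.IsBounded {x | q x ≤ (α : EReal)}

/-- The set of minimizers of `q` over `S`; as usual it is empty if `q` is identically `∞` on `S`. -/
def argminOn (q : E n → EReal) (S : Set (E n)) : Set (E n) :=
  {x | x ∈ S ∧ q x < ⊤ ∧ IsMinOn q S x}

/-- `q` is finite everywhere and twice continuously differentiable on `ℝⁿ`. -/
def IsC2 (q : E n → EReal) : Prop :=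
  (∀ x, q x ≠ ⊥ ∧ q x ≠ ⊤) ∧ ContDiff ℝ 2 (re q)

/-- The Hessian of `q` is positive definite at every point. -/
def HessianPosDef (q : E n → EReal) : Prop :=
  ∀ x v : E n, v ≠ 0 → 0 < fderiv ℝ (fderiv ℝ (re q)) x v v

/-! ### Subdifferentials and the Kurdyka-Łojasiewicz property -/

/-- The regular subdifferential: `q x` is finite and
`liminf_{y → x, y ≠ x} (q y - q x - ⟪v, y - x⟫) / ‖y - x‖ ≥ 0`, written with `ε`'s. -/
def regSubdiff (q : E n → EReal) (x : E n) : Set (E n) :=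
  {v | q x ≠ ⊥ ∧ q x ≠ ⊤ ∧ ∀ ε : ℝ, 0 < ε → ∀ᶠ y in 𝓝 x,
    q x + ((⟪v, y - x⟫_ℝ - ε * ‖y - x‖ : ℝ) : EReal) ≤ q y}

/-- The limiting subdifferential. -/
def limSubdiff (q : E n → EReal) (x : E n) : Set (E n) :=
  {v | x ∈ dom q ∧ ∃ (y w : ℕ → E n), (∀ k, w k ∈ regSubdiff q (y k)) ∧
    Tendsto y atTop (𝓝 x) ∧ Tendsto (fun k => q (y k)) atTop (𝓝 (q x)) ∧
    Tendsto w atTop (𝓝 v)}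

/-- The KL property with exponent `θ`, i.e. with `ψ s = ϱ s ^ (1 - θ)`. The inequality
`ψ' (q w - q w₀) * dist (0, ∂q w) ≥ 1` is required of every `v ∈ ∂q w`, which is the same thing
as `dist (0, ∂q w)` is the infimum of `‖v‖` (and `∞` if `∂q w` is empty). -/
def KLProperty (q : E n → EReal) (θ : ℝ) : Prop :=
  IsProper q ∧ LowerSemicontinuous q ∧
  ∀ w₀ : E n, (limSubdiff q w₀).Nonempty →
    ∃ ε η ϱ : ℝ, 0 < ε ∧ 0 < η ∧ 0 < ϱ ∧
      ∀ w : E n, ‖w - w₀‖ < ε → q w₀ < q w → q w < q w₀ + (η : EReal) →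
        ∀ v ∈ limSubdiff q w,
          1 ≤ ϱ * (1 - θ) * (re q w - re q w₀) ^ (-θ) * ‖v‖

/-- `x` is a stationary point of `q`: `0 ∈ ∂̂q(x)`. -/
def IsStationaryPt (q : E n → EReal) (x : E n) : Prop := (0 : E n) ∈ regSubdiff q x

/-! ### Legendre kernels and relative smoothness -/

/-- Legendre kernels: proper, lsc, strictly convex, `C¹` on the nonempty interior of the domain,
1-coercive (`h x / ‖x‖ → ∞` as `‖x‖ → ∞`) and essentially smooth. -/
structure IsLegendre (h : E n → EReal) : Prop where
  proper : IsProper h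
  lsc : LowerSemicontinuous h
  strictConvex : StrictConvexOn ℝ (dom h) (re h)
  interior_nonempty : (interior (dom h)).Nonempty
  contDiffOn : ContDiffOn ℝ 1 (re h) (interior (dom h))
  coercive : ∀ M : ℝ, ∀ᶠ x in Bornology.cobounded (E n), ((M * ‖x‖ : ℝ) : EReal) ≤ h x
  essSmooth : ∀ (u : ℕ → E n) (x : E n), (∀ k, u k ∈ interior (dom h)) →
    x ∈ frontier (dom h) → Tendsto u atTop (𝓝 x) →
    Tendsto (fun k => ‖gradient (re h) (u k)‖) atTop atTop

/-- `f` is `L`-smooth relative to `h`. -/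
structure IsRelSmooth (L : ℝ) (f h : E n → EReal) : Prop where
  proper : IsProper f
  lsc : LowerSemicontinuous f
  dom_subset : dom h ⊆ dom f
  nonneg : 0 ≤ L
  convex_add : ConvexOn ℝ (interior (dom h)) (fun x => L * re h x + re f x)
  convex_sub : ConvexOn ℝ (interior (dom h)) (fun x => L * re h x - re f x)

/-! ### The problem and its assumptions -/

/-- The cost `φ = (1/N) ∑ᵢ fᵢ + g`. -/
def cost (f : Fin N → E n → EReal) (g : E n → EReal) : E n → EReal :=
  fun x => (((1 / N : ℝ)) : EReal) * ∑ i, f i x + g x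

/-- The open set `C = ⋂ᵢ int dom hᵢ`. -/
def domC (h : Fin N → E n → EReal) : Set (E n) := ⋂ i, interior (dom (h i))

/-- The subproblem `T(s) = argmin_w { g w + ∑ᵢ hᵢ w / γᵢ - ⟪s, w⟫ }`. -/
def subproblem (h : Fin N → E n → EReal) (g : E n → EReal) (γ : Fin N → ℝ) (s : E n) :
    Set (E n) :=
  argminOn (fun w => g w + ∑ i, ((1 / γ i : ℝ) : EReal) * h i w - ((⟪s, w⟫_ℝ : ℝ) : EReal))
    Set.univ

/-- The basic requirements, including the choice `γᵢ ∈ (0, N / Lᵢ)` of the stepsizes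
(an unbounded interval if `Lᵢ = 0`). -/
structure BasicAssumption (f h : Fin N → E n → EReal) (g : E n → EReal) (L γ : Fin N → ℝ) :
    Prop where
  legendre : ∀ i, IsLegendre (h i)
  relSmooth : ∀ i, IsRelSmooth (L i) (f i) (h i)
  g_proper : IsProper g
  g_lsc : LowerSemicontinuous g
  solution : (argminOn (cost f g) (closure (domC h))).Nonempty
  step_pos : ∀ i, 0 < γ i
  step_lt : ∀ i, γ i * L i < N
  range_subset : ∀ s, subproblem h g γ s ⊆ domC h

/-- The global convergence requirements, with KL exponent `θ ∈ (0, 1)`. -/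
structure KLAssumption (f h : Fin N → E n → EReal) (g : E n → EReal) (θ : ℝ) : Prop where
  f_C2 : ∀ i, IsC2 (f i)
  h_C2 : ∀ i, IsC2 (h i)
  h_hessian : ∀ i, HessianPosDef (h i)
  theta_pos : 0 < θ
  theta_lt_one : θ < 1
  kl : KLProperty (cost f g) θ
  levelBounded : LevelBounded (cost f g)

/-! ### The low-memory algorithm -/

/-- `(1 / γᵢ) ∇hᵢ(x) - (1 / N) ∇fᵢ(x)`. -/
def sEntry (f h : Fin N → E n → EReal) (γ : Fin N → ℝ) (i : Fin N) (x : E n) : E n :=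
  (1 / γ i) • gradient (re (h i)) x - (1 / N : ℝ) • gradient (re (f i)) x

/-- The sequences `s = s̃`, `z`, `zt = z̃`, `I` and `K` are generated by the low-memory Bregman
Finito/MISO algorithm started at `xinit`. The minimizer `z k` and the index set `I (k + 1)` may be
any admissible choice. As `K 0 = ∅`, the rule `zt k = zt (k - 1)` is only used for `k ≥ 1`. -/
structure IsLowMemoryRun (f h : Fin N → E n → EReal) (g : E n → EReal) (γ : Fin N → ℝ)
    (xinit : E n) (s z zt : ℕ → E n) (I K : ℕ → Finset (Fin N)) : Prop where
  xinit_mem : xinit ∈ domC h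
  s_zero : s 0 = ∑ i, sEntry f h γ i xinit
  K_zero : K 0 = ∅
  z_mem : ∀ k, z k ∈ subproblem h g γ (s k)
  full : ∀ k, K k = ∅ →
    I (k + 1) = Finset.univ ∧ K (k + 1) = Finset.univ ∧ zt k = z k ∧
      s (k + 1) = ∑ i, sEntry f h γ i (z k)
  incremental : ∀ k, K k ≠ ∅ →
    (I (k + 1)).Nonempty ∧ I (k + 1) ⊆ K k ∧ K (k + 1) = K k \ I (k + 1) ∧ zt k = zt (k - 1) ∧
      s (k + 1) = s k + ∑ i ∈ I (k + 1), (sEntry f h γ i (z k) - sEntry f h γ i (zt k))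

/-- `u` converges to `a` at `R`-linear rate. -/
def RLinearTo {X : Type*} [PseudoMetricSpace X] (u : ℕ → X) (a : X) : Prop :=
  ∃ c ρ : ℝ, 0 < c ∧ c < 1 ∧ 0 < ρ ∧ ∀ k : ℕ, dist (u k) a ≤ ρ * c ^ k

end BregmanFinito

end

open BregmanFinito

/-!
Write `Hᵢ = hᵢ / γᵢ - fᵢ / N` (`kernel`) and let `Dᵢ` be its Bregman distance. Relative smoothness
and `γᵢ Lᵢ < N` make `Hᵢ` inherit strong convexity on balls from `hᵢ` (`exists_le_bregman_kernel`).
The vector `s k` is the sum of the gradients `∇Hᵢ` at points `yᵢ` stored in a table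
(`IsLowMemoryRun.s_eq`), so that `z k` minimizes `φ + ∑ᵢ Dᵢ(·, yᵢ)`: the iteration is a Bregman
proximal point method with delayed information.

The values of these minimization problems decrease by `Dᵢ(z k, yᵢ)` for each entry that is
replaced (`IsLowMemoryRun.value_descent`). In an epoch, from one full update to the next, every
entry is replaced exactly once, and the entry that is replaced is the epoch's starting point
`x j`. Summing over the epoch gives `φ(x (j+1)) + ∑ᵢ Dᵢ(x (j+1), yᵢ) + ∑ᵢ Dᵢ(yᵢ, x j) ≤ φ(x j)`
(`InEpoch`). By level boundedness all points stay in a ball, and with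
`Δ j = ∑ᵢ (‖x (j+1) - yᵢ‖ + ‖yᵢ - x j‖)` this is a sufficient decrease `a Δ j ^ 2` of the cost.
Optimality of `x (j+1)` puts `∑ᵢ (∇Hᵢ(yᵢ) - ∇Hᵢ(x (j+1)))` into the regular subdifferential of `φ`
there, and its norm is at most a multiple of `Δ j`.

These two facts are what the usual Kurdyka-Łojasiewicz argument needs (`tendsto_of_KL`): cluster
points of `x` are limits of minimizers, hence stationary (`IsTiltedMin.of_tendsto`), the KL
inequality at one of them makes `Δ` summable and traps the sequence near it, and the recursion
`δ (j+1) ^ (2 θ) ≤ A (δ j - δ (j+1))` for `δ j = φ(x j) - φ(x⋆)` yields the rates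
(`exists_geometric_bound`, `exists_polynomial_bound`). As an epoch takes at most `N + 1`
iterations and `zt` is constant on it, the rates in `j` are rates in `k`.
-/

namespace BregmanFinito

/-! ### Sequences satisfying a Kurdyka-Łojasiewicz inequality -/

/-- An asymptotic bound by a positive sequence holds from the start after enlarging the constant. -/
lemma exists_forall_le_mul_of_eventually {u w : ℕ → ℝ} (hw : ∀ m, 0 < w m) {ρ : ℝ}
    (h : ∀ᶠ m in atTop, u m ≤ ρ * w m) : ∃ ρ' : ℝ, 0 < ρ' ∧ ∀ m, u m ≤ ρ' * w m := by
  obtain ⟨J, hJ⟩ := eventually_atTop.1 h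
  have hS : 0 ≤ ∑ i ∈ Finset.range J, |u i| / w i :=
    Finset.sum_nonneg fun i _ => div_nonneg (abs_nonneg _) (hw i).le
  refine ⟨|ρ| + 1 + ∑ i ∈ Finset.range J, |u i| / w i, by positivity, fun m => ?_⟩
  rcases le_or_gt J m with hm | hm
  · refine (hJ m hm).trans (mul_le_mul_of_nonneg_right ?_ (hw m).le)
    linarith [le_abs_self ρ]
  · have h1 : |u m| / w m ≤ ∑ i ∈ Finset.range J, |u i| / w i :=
      Finset.single_le_sum (f := fun i => |u i| / w i)
        (fun i _ => div_nonneg (abs_nonneg _) (hw i).le) (Finset.mem_range.2 hm)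
    have h2 : |u m| / w m * w m = |u m| := div_mul_cancel₀ _ (hw m).ne'
    have h3 : |u m| / w m * w m ≤ (|ρ| + 1 + ∑ i ∈ Finset.range J, |u i| / w i) * w m :=
      mul_le_mul_of_nonneg_right (by linarith [abs_nonneg ρ]) (hw m).le
    linarith [le_abs_self (u m)]

/-- The tangent inequality for the concave function `t ↦ t ^ (1 - θ)`. -/
lemma mul_sub_le_rpow_sub_rpow {θ a b : ℝ} (hθ0 : 0 < θ) (hθ1 : θ < 1) (ha : 0 < a) (hb : 0 ≤ b) :
    (1 - θ) * (a - b) ≤ a ^ θ * (a ^ (1 - θ) - b ^ (1 - θ)) := by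
  have hB := rpow_one_add_le_one_add_mul_self (s := b / a - 1) (p := 1 - θ)
    (by linarith [div_nonneg hb ha.le]) (by linarith) (by linarith)
  rw [add_sub_cancel, Real.div_rpow hb ha.le, div_le_iff₀ (Real.rpow_pos_of_pos ha _)] at hB
  have hmul : a ^ θ * a ^ (1 - θ) = a := by
    rw [← Real.rpow_add ha]; simp
  have h2 := mul_le_mul_of_nonneg_left hB (Real.rpow_pos_of_pos ha θ).le
  have h3 : a ^ θ * ((1 + (1 - θ) * (b / a - 1)) * a ^ (1 - θ)) = a + (1 - θ) * (b - a) := by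
    calc _ = (a ^ θ * a ^ (1 - θ)) * (1 + (1 - θ) * (b / a - 1)) := by ring
      _ = _ := by rw [hmul]; field_simp
  rw [mul_sub (a ^ θ), hmul]
  linarith

/-- One step of the finite length argument: sufficient decrease and the KL inequality bound the
step length by the previous one and the decrease of the desingularized cost. -/
lemma two_mul_step_le {θ a C δ₀ δ₁ Δ₀ Δ₁ : ℝ} (hθ0 : 0 < θ) (hθ1 : θ < 1) (ha : 0 < a)
    (hC : 0 ≤ C) (hδ₁ : 0 ≤ δ₁) (hΔ₀ : 0 ≤ Δ₀) (hdesc : a * Δ₁ ^ 2 ≤ δ₀ - δ₁)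
    (hKL : 0 < δ₀ → δ₀ ^ θ ≤ C * Δ₀) :
    2 * Δ₁ ≤ Δ₀ + C / (a * (1 - θ)) * (δ₀ ^ (1 - θ) - δ₁ ^ (1 - θ)) := by
  have hδ : δ₁ ≤ δ₀ := by nlinarith [sq_nonneg Δ₁]
  have hψ : 0 ≤ δ₀ ^ (1 - θ) - δ₁ ^ (1 - θ) :=
    sub_nonneg.2 (Real.rpow_le_rpow hδ₁ hδ (by linarith))
  have hc : 0 < a * (1 - θ) := mul_pos ha (by linarith)
  set q := C / (a * (1 - θ)) * (δ₀ ^ (1 - θ) - δ₁ ^ (1 - θ)) with hq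
  have hq0 : 0 ≤ q := mul_nonneg (div_nonneg hC hc.le) hψ
  have hsq : Δ₁ ^ 2 ≤ Δ₀ * q := by
    rcases (hδ₁.trans hδ).eq_or_lt with h0 | h0
    · have : a * Δ₁ ^ 2 ≤ 0 := by linarith
      have h4 : Δ₁ ^ 2 ≤ 0 := by
        by_contra hcon
        push Not at hcon
        linarith [mul_pos ha hcon]
      exact h4.trans (mul_nonneg hΔ₀ hq0)
    · have h1 := mul_sub_le_rpow_sub_rpow hθ0 hθ1 h0 hδ₁
      have h2 := mul_le_mul_of_nonneg_right (hKL h0) hψ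
      have h3 := mul_le_mul_of_nonneg_left hdesc (by linarith : 0 ≤ 1 - θ)
      have h4 : Δ₀ * q = (C * Δ₀ * (δ₀ ^ (1 - θ) - δ₁ ^ (1 - θ))) / (a * (1 - θ)) := by
        rw [hq]; ring
      rw [h4, le_div_iff₀ hc]
      linarith
  have : |2 * Δ₁| ≤ |Δ₀ + q| := by
    apply sq_le_sq.1
    nlinarith [sq_nonneg (Δ₀ - q)]
  rw [abs_of_nonneg (add_nonneg hΔ₀ hq0)] at this
  exact (le_abs_self _).trans this

/-- A sequence with steps at most `Δ` and sufficient decrease `a * Δ² ≤ δ j - δ (j + 1)` that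
satisfies the KL inequality near a cluster point converges to it. The bound on its distance to the
limit comes from the telescoping estimate of the length of its tail. -/
theorem tendsto_of_KL {X : Type*} [PseudoMetricSpace X] {x : ℕ → X} {x₀ : X} {δ Δ : ℕ → ℝ}
    {θ a C ε η : ℝ} (hθ0 : 0 < θ) (hθ1 : θ < 1) (ha : 0 < a) (hC : 0 ≤ C) (hε : 0 < ε)
    (hη : 0 < η) (hΔ0 : ∀ j, 0 ≤ Δ j) (hδ0 : ∀ j, 0 ≤ δ j) (hδ : Tendsto δ atTop (𝓝 0))
    (hdesc : ∀ j, a * Δ j ^ 2 ≤ δ j - δ (j + 1)) (hdist : ∀ j, dist (x j) (x (j + 1)) ≤ Δ j)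
    (hclus : MapClusterPt x₀ atTop x)
    (hKL : ∀ j, dist (x (j + 1)) x₀ < ε → 0 < δ (j + 1) → δ (j + 1) < η →
      δ (j + 1) ^ θ ≤ C * Δ j) :
    Tendsto x atTop (𝓝 x₀) ∧ ∀ᶠ m in atTop, δ (m + 1) ^ θ ≤ C * Δ m ∧
      dist (x (m + 1)) x₀ ≤ Δ m + C / (a * (1 - θ)) * δ (m + 1) ^ (1 - θ) := by
  set κ := C / (a * (1 - θ)) with hκ
  have hκ0 : 0 ≤ κ := div_nonneg hC (mul_nonneg ha.le (by linarith))
  have hψ0 : ∀ j, 0 ≤ δ j ^ (1 - θ) := fun j => Real.rpow_nonneg (hδ0 j) _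
  -- the tail bound: it tends to `0`
  set B : ℕ → ℝ := fun m => Δ m + κ * δ (m + 1) ^ (1 - θ) with hB
  have hB0 : ∀ m, 0 ≤ B m := fun m => add_nonneg (hΔ0 m) (mul_nonneg hκ0 (hψ0 _))
  have hδ' : Tendsto (fun m => δ (m + 1)) atTop (𝓝 0) := hδ.comp (tendsto_add_atTop_nat 1)
  have hBlim : Tendsto B atTop (𝓝 0) := by
    have h1 : Tendsto (fun m => δ (m + 1) ^ (1 - θ)) atTop (𝓝 0) := by
      have := hδ'.rpow_const (p := 1 - θ) (Or.inr (by linarith))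
      rwa [Real.zero_rpow (by linarith)] at this
    have h2 : Tendsto Δ atTop (𝓝 0) := by
      have h3 : Tendsto (fun m => Real.sqrt (δ m / a)) atTop (𝓝 0) := by
        have := (hδ.div_const a).sqrt
        simpa using this
      refine squeeze_zero hΔ0 (fun m => Real.le_sqrt_of_sq_le ?_) h3
      rw [le_div_iff₀ ha]
      linarith [hdesc m, hδ0 (m + 1)]
    simpa [hB] using h2.add (h1.const_mul κ)
  -- from an index close to the cluster point on, the sequence cannot leave the KL neighbourhood
  have trap : ∀ r, 0 < r → r ≤ ε → ∀ J, dist (x (J + 1)) x₀ + B J < r →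
      (∀ m, J ≤ m → δ (m + 1) < η) →
      ∀ m, J ≤ m → dist (x (m + 1)) x₀ < r ∧ dist (x (m + 1)) (x (J + 1)) + B m ≤ B J := by
    intro r hr hrε J hJ hJη m hm
    induction m, hm using Nat.le_induction with
    | base => exact ⟨by linarith [hB0 J], by simp⟩
    | succ m hm ih =>
      have hstep := two_mul_step_le hθ0 hθ1 ha hC (hδ0 (m + 2)) (hΔ0 m) (hdesc (m + 1))
        (fun h => hKL m (ih.1.trans_le hrε) h (hJη m hm))
      rw [← hκ] at hstep
      have hb : dist (x (m + 1 + 1)) (x (J + 1)) + B (m + 1) ≤ B J := by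
        have h1 := dist_triangle_left (x (m + 1 + 1)) (x (J + 1)) (x (m + 1))
        have h2 := hdist (m + 1)
        have h3 := ih.2
        simp only [hB] at h3 ⊢
        linarith
      refine ⟨?_, hb⟩
      have := dist_triangle (x (m + 1 + 1)) (x (J + 1)) x₀
      linarith [hB0 (m + 1)]
  obtain ⟨J₀, hJ₀⟩ := eventually_atTop.1 (hδ'.eventually (gt_mem_nhds hη))
  have start : ∀ r, 0 < r → ∃ J, J₀ ≤ J ∧ dist (x (J + 1)) x₀ + B J < r := by
    intro r hr
    have h1 : ∃ᶠ m in atTop, dist (x m) x₀ < r / 2 :=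
      hclus.frequently (Metric.ball_mem_nhds x₀ (half_pos hr))
    obtain ⟨J₁, hJ₁⟩ := eventually_atTop.1 (hBlim.eventually (gt_mem_nhds (half_pos hr)))
    obtain ⟨m, hm, hmx⟩ := frequently_atTop.1 h1 (max J₀ J₁ + 1)
    obtain ⟨k, rfl⟩ : ∃ k, m = k + 1 := ⟨m - 1, by omega⟩
    have hk : max J₀ J₁ ≤ k := by omega
    exact ⟨k, (le_max_left _ _).trans hk, by linarith [hJ₁ k ((le_max_right _ _).trans hk)]⟩
  have hlim : Tendsto x atTop (𝓝 x₀) := by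
    rw [← tendsto_add_atTop_iff_nat 1, Metric.tendsto_atTop]
    intro r hr
    obtain ⟨J, hJ, hJr⟩ := start (min r ε) (lt_min hr hε)
    exact ⟨J, fun m hm => ((trap _ (lt_min hr hε) (min_le_right _ _) J hJr
      (fun k hk => hJ₀ k (hJ.trans hk)) m hm).1).trans_le (min_le_left _ _)⟩
  refine ⟨hlim, ?_⟩
  have hev : ∀ᶠ m in atTop, dist (x (m + 1)) x₀ + B m < ε := by
    have h1 : Tendsto (fun m => dist (x (m + 1)) x₀ + B m) atTop (𝓝 0) := by
      have := (tendsto_iff_dist_tendsto_zero.1 (hlim.comp (tendsto_add_atTop_nat 1))).add hBlim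
      simpa using this
    exact h1.eventually (gt_mem_nhds hε)
  filter_upwards [hev, eventually_ge_atTop J₀] with m hm hmJ
  constructor
  · rcases (hδ0 (m + 1)).eq_or_lt with h0 | h0
    · rw [← h0, Real.zero_rpow hθ0.ne']
      exact mul_nonneg hC (hΔ0 m)
    · exact hKL m (by linarith [hB0 m]) h0 (hJ₀ m hmJ)
  · have h2 := fun k hk => (trap ε hε le_rfl m hm (fun k hk => hJ₀ k (hmJ.trans hk)) k hk).2
    have h3 : Tendsto (fun k => dist (x (k + 1)) (x (m + 1))) atTop (𝓝 (dist x₀ (x (m + 1)))) :=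
      (hlim.comp (tendsto_add_atTop_nat 1)).dist tendsto_const_nhds
    rw [dist_comm]
    refine le_of_tendsto h3 ?_
    filter_upwards [eventually_ge_atTop m] with k hk
    linarith [h2 k hk, hB0 k]

/-- If `δ (m + 1) ^ (2 * θ)` is bounded by the decrease of `δ` and `θ ≤ 1 / 2`, then `δ` decays
geometrically. -/
lemma exists_geometric_bound {δ : ℕ → ℝ} {θ A : ℝ} (hθ0 : 0 < θ) (hθ : θ ≤ 1 / 2) (hA : 0 < A)
    (hδ0 : ∀ j, 0 ≤ δ j) (hδ : Tendsto δ atTop (𝓝 0))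
    (h : ∀ᶠ m in atTop, δ (m + 1) ^ (2 * θ) ≤ A * (δ m - δ (m + 1))) :
    ∃ c ρ : ℝ, 0 < c ∧ c < 1 ∧ 0 < ρ ∧ ∀ m, δ m ≤ ρ * c ^ m := by
  have hc0 : 0 < A / (1 + A) := by positivity
  have hc1 : A / (1 + A) < 1 := by rw [div_lt_one (by positivity)]; linarith
  have h1 : ∀ᶠ m in atTop, δ (m + 1) ≤ A / (1 + A) * δ m := by
    filter_upwards [h, (hδ.comp (tendsto_add_atTop_nat 1)).eventually (gt_mem_nhds one_pos)]
      with m hm hm1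
    have h2 : δ (m + 1) ≤ δ (m + 1) ^ (2 * θ) := by
      rcases (hδ0 (m + 1)).eq_or_lt with h0 | h0
      · rw [← h0, Real.zero_rpow (by positivity)]
      · calc δ (m + 1) = δ (m + 1) ^ (1 : ℝ) := (Real.rpow_one _).symm
          _ ≤ _ := Real.rpow_le_rpow_of_exponent_ge h0 hm1.le (by linarith)
    rw [div_mul_eq_mul_div, le_div_iff₀ (by positivity)]
    linarith
  obtain ⟨J, hJ⟩ := eventually_atTop.1 h1
  have h2 : ∀ m, J ≤ m → δ m ≤ (δ J / (A / (1 + A)) ^ J) * (A / (1 + A)) ^ m := by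
    intro m hm
    induction m, hm using Nat.le_induction with
    | base => rw [div_mul_cancel₀ _ (pow_pos hc0 J).ne']
    | succ m hm ih =>
      refine (hJ m hm).trans ?_
      calc _ ≤ A / (1 + A) * ((δ J / (A / (1 + A)) ^ J) * (A / (1 + A)) ^ m) :=
            mul_le_mul_of_nonneg_left ih hc0.le
        _ = _ := by ring
  obtain ⟨ρ, hρ, hb⟩ := exists_forall_le_mul_of_eventually (u := δ)
    (fun m => pow_pos hc0 m) (eventually_atTop.2 ⟨J, h2⟩)
  exact ⟨_, ρ, hc0, hc1, hρ, hb⟩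

lemma rpow_neg_sub_rpow_neg_le {q y : ℝ} (hq : 1 ≤ q) (hy : 1 ≤ y) :
    y ^ (-q) - (y + 1) ^ (-q) ≤ q * 2 ^ q * (y + 1) ^ (-q - 1) := by
  have hy0 : 0 < y := by linarith
  have hy1 : 0 < y + 1 := by linarith
  have hB := one_add_mul_self_le_rpow_one_add (s := -(1 / (y + 1))) (p := q)
    (by rw [neg_le_neg_iff, div_le_one hy1]; linarith) hq
  have e : 1 + -(1 / (y + 1)) = y / (y + 1) := by field_simp; ring
  rw [e, Real.div_rpow hy0.le hy1.le] at hB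
  have hyq := Real.rpow_pos_of_pos hy0 q
  have hyq1 := Real.rpow_pos_of_pos hy1 q
  have h2 : (y + 1) ^ q ≤ 2 ^ q * y ^ q := by
    rw [← Real.mul_rpow (by norm_num) hy0.le]
    exact Real.rpow_le_rpow hy1.le (by linarith) (by linarith)
  rw [Real.rpow_sub hy1, Real.rpow_one, Real.rpow_neg hy0.le, Real.rpow_neg hy1.le]
  have h3 : (y ^ q)⁻¹ - ((y + 1) ^ q)⁻¹ = (y ^ q)⁻¹ * (1 - y ^ q / (y + 1) ^ q) := by
    field_simp
  have h4 : (y ^ q)⁻¹ ≤ 2 ^ q * ((y + 1) ^ q)⁻¹ := by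
    rw [← div_eq_mul_inv, le_div_iff₀ hyq1, inv_mul_le_iff₀ hyq]
    linarith
  calc _ = (y ^ q)⁻¹ * (1 - y ^ q / (y + 1) ^ q) := h3
    _ ≤ (y ^ q)⁻¹ * (q * (1 / (y + 1))) := by
      apply mul_le_mul_of_nonneg_left _ (inv_pos.2 hyq).le
      linarith
    _ ≤ (2 ^ q * ((y + 1) ^ q)⁻¹) * (q * (1 / (y + 1))) := by
      apply mul_le_mul_of_nonneg_right h4 (by positivity)
    _ = _ := by ring

/-- If `δ (m + 1) ^ (2 * θ)` is bounded by the decrease of `δ` and `1 / 2 < θ < 1`, then `δ`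
decays like `m ^ (-1 / (2 * θ - 1))`. -/
lemma exists_polynomial_bound {δ : ℕ → ℝ} {θ A : ℝ} (hθ : 1 / 2 < θ) (hθ1 : θ < 1) (hA : 0 < A)
    (h : ∀ᶠ m in atTop, δ (m + 1) ^ (2 * θ) ≤ A * (δ m - δ (m + 1))) :
    ∃ c : ℝ, 0 < c ∧ ∀ m : ℕ, δ m ≤ c * ((m : ℝ) + 1) ^ (-(1 / (2 * θ - 1))) := by
  have hp : 0 < 2 * θ - 1 := by linarith
  set q := 1 / (2 * θ - 1) with hq
  have hq1 : 1 ≤ q := by rw [hq, le_div_iff₀ hp]; linarith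
  have hpos : ∀ m : ℕ, (0 : ℝ) < (m : ℝ) + 1 := fun m => by positivity
  obtain ⟨J, hJ⟩ := eventually_atTop.1 h
  -- `c` is so large that `c * (m + 1) ^ (-q)` decreases too slowly to be overtaken by `δ`
  set d := A * (q * 2 ^ q) with hd
  have hd0 : 0 < d := by positivity
  obtain ⟨c, hc0, hcJ, hcd⟩ : ∃ c : ℝ, 0 < c ∧ δ J ≤ c * ((J : ℝ) + 1) ^ (-q) ∧
      c * d ≤ c ^ (2 * θ) := by
    refine ⟨max (δ J * ((J : ℝ) + 1) ^ q) (d ^ q), ?_, ?_, ?_⟩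
    · exact lt_max_of_lt_right (Real.rpow_pos_of_pos hd0 _)
    · rw [Real.rpow_neg (hpos J).le, ← div_eq_mul_inv,
        le_div_iff₀ (Real.rpow_pos_of_pos (hpos J) _)]
      exact le_max_left _ _
    · have hc0 : 0 < max (δ J * ((J : ℝ) + 1) ^ q) (d ^ q) :=
        lt_max_of_lt_right (Real.rpow_pos_of_pos hd0 _)
      have h1 : d ≤ (max (δ J * ((J : ℝ) + 1) ^ q) (d ^ q)) ^ (2 * θ - 1) := by
        have h2 := Real.rpow_le_rpow (Real.rpow_pos_of_pos hd0 q).le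
          (le_max_right (δ J * ((J : ℝ) + 1) ^ q) (d ^ q)) hp.le
        rwa [← Real.rpow_mul hd0.le, hq, one_div_mul_cancel hp.ne', Real.rpow_one] at h2
      calc _ ≤ _ := mul_le_mul_of_nonneg_left h1 hc0.le
        _ = _ := by
          rw [Real.rpow_sub hc0, Real.rpow_one]; field_simp
  have hind : ∀ m, J ≤ m → δ m ≤ c * ((m : ℝ) + 1) ^ (-q) := by
    intro m hm
    induction m, hm using Nat.le_induction with
    | base => exact hcJ
    | succ m hm ih =>
      by_contra! hcon
      push_cast at hcon
      have hm1 : (1 : ℝ) ≤ (m : ℝ) + 1 := by linarith [Nat.cast_nonneg (α := ℝ) m]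
      have hy1 : (0 : ℝ) < (m : ℝ) + 1 + 1 := by linarith
      have h1 := rpow_neg_sub_rpow_neg_le hq1 hm1
      have h2 : (c * ((m : ℝ) + 1 + 1) ^ (-q)) ^ (2 * θ) < δ (m + 1) ^ (2 * θ) :=
        Real.rpow_lt_rpow (by positivity) hcon (by linarith)
      have h3 : (c * ((m : ℝ) + 1 + 1) ^ (-q)) ^ (2 * θ)
          = c ^ (2 * θ) * ((m : ℝ) + 1 + 1) ^ (-q - 1) := by
        rw [Real.mul_rpow hc0.le (Real.rpow_nonneg hy1.le _), ← Real.rpow_mul hy1.le]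
        congr 2
        rw [hq]; field_simp; ring
      have h4 := hJ m hm
      have h5 := mul_le_mul_of_nonneg_left h1 (mul_pos hA hc0).le
      have h6 : A * c * (q * 2 ^ q * ((m : ℝ) + 1 + 1) ^ (-q - 1))
          = c * d * ((m : ℝ) + 1 + 1) ^ (-q - 1) := by rw [hd]; ring
      have h7 := mul_le_mul_of_nonneg_right hcd (Real.rpow_nonneg hy1.le (-q - 1))
      have h8 : A * (δ m - δ (m + 1)) ≤
          A * (c * ((m : ℝ) + 1) ^ (-q) - c * ((m : ℝ) + 1 + 1) ^ (-q)) :=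
        mul_le_mul_of_nonneg_left (by linarith) hA.le
      linarith
  exact exists_forall_le_mul_of_eventually (u := δ)
    (fun m => Real.rpow_pos_of_pos (hpos m) _) (eventually_atTop.2 ⟨J, hind⟩)

/-! ### Bregman distances -/

/-- The Bregman distance `D(x, y) = F x - F y - ⟪∇F y, x - y⟫` of a real-valued function. -/
noncomputable def bregman {n : ℕ} (F : E n → ℝ) (x y : E n) : ℝ :=
  F x - F y - ⟪gradient F y, x - y⟫_ℝ

lemma bregman_self {n : ℕ} (F : E n → ℝ) (x : E n) : bregman F x x = 0 := by
  simp [bregman]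

lemma contDiff_gradient {n : ℕ} {F : E n → ℝ} (hF : ContDiff ℝ 2 F) :
    ContDiff ℝ 1 (gradient F) :=
  ((InnerProductSpace.toDual ℝ (E n)).symm.contDiff).comp (hF.fderiv_right (by norm_num))

lemma hasDerivAt_comp_line {n : ℕ} {F : E n → ℝ} (hF : Differentiable ℝ F) (y d : E n) (t : ℝ) :
    HasDerivAt (fun t : ℝ => F (y + t • d)) (fderiv ℝ F (y + t • d) d) t := by
  have h1 : HasDerivAt (fun t : ℝ => y + t • d) d t := by
    simpa using ((hasDerivAt_id t).smul_const d).const_add y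
  exact (hF (y + t • d)).hasFDerivAt.comp_hasDerivAt t h1

lemma bregman_nonneg_of_convexOn {n : ℕ} {F : E n → ℝ} (hF : Differentiable ℝ F)
    (hc : ConvexOn ℝ Set.univ F) (x y : E n) : 0 ≤ bregman F x y := by
  have h1 : ConvexOn ℝ Set.univ (fun t : ℝ => F (y + t • (x - y))) := by
    have := hc.comp_affineMap (AffineMap.lineMap y x : ℝ →ᵃ[ℝ] E n)
    have e : (fun t : ℝ => F (y + t • (x - y))) = F ∘ (AffineMap.lineMap y x : ℝ →ᵃ[ℝ] E n) := by
      ext t; simp [AffineMap.lineMap_apply, add_comm]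
    rw [e]; simpa using this
  have h2 := h1.le_slope_of_hasDerivAt (Set.mem_univ 0) (Set.mem_univ 1) zero_lt_one
    (hasDerivAt_comp_line hF y (x - y) 0)
  rw [slope_def_field] at h2
  simp only [zero_smul, add_zero, one_smul, add_sub_cancel, sub_zero, div_one] at h2
  rw [bregman, inner_gradient_left]
  linarith

/-- By compactness, a positive definite continuous Hessian is uniformly positive definite on
balls. -/
lemma exists_hessian_lower_bound {n : ℕ} {F : E n → ℝ} (hF : ContDiff ℝ 2 F)
    (hpos : ∀ x v : E n, v ≠ 0 → 0 < fderiv ℝ (fderiv ℝ F) x v v) (R : ℝ) :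
    ∃ m : ℝ, 0 < m ∧ ∀ x ∈ Metric.closedBall (0 : E n) R, ∀ v,
      m * ‖v‖ ^ 2 ≤ fderiv ℝ (fderiv ℝ F) x v v := by
  have hc : Continuous (fderiv ℝ (fderiv ℝ F)) :=
    ((hF.fderiv_right (m := 1) (by norm_num)).continuous_fderiv (by norm_num))
  have hc2 : Continuous fun p : E n × E n => fderiv ℝ (fderiv ℝ F) p.1 p.2 p.2 :=
    ((hc.comp continuous_fst).clm_apply continuous_snd).clm_apply continuous_snd
  have hK : IsCompact (Metric.closedBall (0 : E n) R ×ˢ Metric.sphere (0 : E n) 1) :=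
    (isCompact_closedBall _ _).prod (isCompact_sphere _ _)
  have key : ∃ m : ℝ, 0 < m ∧ ∀ p ∈ Metric.closedBall (0 : E n) R ×ˢ Metric.sphere (0 : E n) 1,
      m ≤ fderiv ℝ (fderiv ℝ F) p.1 p.2 p.2 := by
    refine hK.exists_forall_le' hc2.continuousOn (a := 0) fun p hp => hpos _ _ ?_
    have : ‖p.2‖ = 1 := by simpa using hp.2
    intro h0
    simp [h0] at this
  obtain ⟨m, hm, hmb⟩ := key
  refine ⟨m, hm, fun x hx v => ?_⟩
  rcases eq_or_ne v 0 with rfl | hv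
  · simp
  · have hv' : ‖v‖ ≠ 0 := norm_ne_zero_iff.2 hv
    have h1 := hmb (x, ‖v‖⁻¹ • v) ⟨hx, by simp [norm_smul, hv']⟩
    simp only [map_smul, smul_apply, smul_eq_mul] at h1
    have h2 := mul_le_mul_of_nonneg_right h1 (sq_nonneg ‖v‖)
    have h3 : ‖v‖⁻¹ * (‖v‖⁻¹ * fderiv ℝ (fderiv ℝ F) x v v) * ‖v‖ ^ 2
        = fderiv ℝ (fderiv ℝ F) x v v := by field_simp
    linarith

lemma le_bregman_of_hessian_lower_bound {n : ℕ} {F : E n → ℝ} (hF : ContDiff ℝ 2 F) {m : ℝ}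
    {S : Set (E n)} (hS : Convex ℝ S)
    (hm : ∀ x ∈ S, ∀ v, m * ‖v‖ ^ 2 ≤ fderiv ℝ (fderiv ℝ F) x v v)
    {x y : E n} (hx : x ∈ S) (hy : y ∈ S) : m / 2 * ‖x - y‖ ^ 2 ≤ bregman F x y := by
  set d := x - y with hd
  have hdiff : Differentiable ℝ F := hF.differentiable (by norm_num)
  have hdiff' : Differentiable ℝ (fderiv ℝ F) :=
    (hF.fderiv_right (m := 1) (by norm_num)).differentiable (by norm_num)
  have hmem : ∀ t ∈ Set.Icc (0 : ℝ) 1, y + t • d ∈ S := fun t ht => by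
    exact hS.add_smul_sub_mem hy hx ht
  -- subtracting the quadratic leaves a function on the segment with nonnegative second derivative
  have hp : ∀ t : ℝ, HasDerivAt (fun t : ℝ => F (y + t • d) - m / 2 * ‖d‖ ^ 2 * t ^ 2)
      (fderiv ℝ F (y + t • d) d - m * ‖d‖ ^ 2 * t) t := fun t => by
    have := (hasDerivAt_comp_line hdiff y d t).sub
      ((hasDerivAt_pow 2 t).const_mul (m / 2 * ‖d‖ ^ 2))
    refine this.congr_deriv ?_
    norm_num; ring
  have hp' : ∀ t : ℝ, HasDerivAt (fun t : ℝ => fderiv ℝ F (y + t • d) d - m * ‖d‖ ^ 2 * t)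
      (fderiv ℝ (fderiv ℝ F) (y + t • d) d d - m * ‖d‖ ^ 2) t := fun t => by
    have h1 : HasDerivAt (fun t : ℝ => y + t • d) d t := by
      simpa using ((hasDerivAt_id t).smul_const d).const_add y
    have h2 := (hdiff' (y + t • d)).hasFDerivAt.comp_hasDerivAt t h1
    have h3 := h2.clm_apply (hasDerivAt_const t d)
    have := h3.sub ((hasDerivAt_id t).const_mul (m * ‖d‖ ^ 2))
    refine this.congr_deriv ?_
    simp
  obtain ⟨ξ, hξ, hξe⟩ := exists_hasDerivAt_eq_slope _ _ zero_lt_one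
    (fun t _ => (hp t).continuousAt.continuousWithinAt) (fun t _ => hp t)
  obtain ⟨ζ, hζ, hζe⟩ := exists_hasDerivAt_eq_slope _ _ hξ.1
    (fun t _ => (hp' t).continuousAt.continuousWithinAt) (fun t _ => hp' t)
  have h1 := hm _ (hmem ζ ⟨hζ.1.le, (hζ.2.trans hξ.2).le⟩) d
  have h2 : 0 ≤ fderiv ℝ (fderiv ℝ F) (y + ζ • d) d d - m * ‖d‖ ^ 2 := by linarith
  rw [hζe, sub_zero, le_div_iff₀ hξ.1, hξe] at h2
  have hyx : y + d = x := by simp [hd]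
  simp only [zero_smul, add_zero, one_smul, hyx] at h2
  rw [bregman, inner_gradient_left, ← hd]
  norm_num at h2
  linarith

lemma exists_gradient_lipschitz {n : ℕ} {F : E n → ℝ} (hF : ContDiff ℝ 2 F) (R : ℝ) :
    ∃ Λ : ℝ, 0 ≤ Λ ∧ ∀ x ∈ Metric.closedBall (0 : E n) R, ∀ y ∈ Metric.closedBall (0 : E n) R,
      ‖gradient F x - gradient F y‖ ≤ Λ * ‖x - y‖ := by
  obtain ⟨Λ, hΛ⟩ := ((contDiff_gradient hF).locallyLipschitz.locallyLipschitzOn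
    (s := Metric.closedBall (0 : E n) R)).exists_lipschitzOnWith_of_compact
    (isCompact_closedBall _ _)
  exact ⟨Λ, Λ.2, fun x hx y hy => hΛ.norm_sub_le hx hy⟩

/-! ### Minimizers of tilted costs -/

/-- `z` minimizes `q + H - ⟪s, ·⟫` over the points where `q` is finite. -/
def IsTiltedMin {n : ℕ} (q : E n → EReal) (H : E n → ℝ) (s z : E n) : Prop :=
  q z ≠ ⊤ ∧ ∀ w, q w ≠ ⊤ → re q z + H z - ⟪s, z⟫_ℝ ≤ re q w + H w - ⟪s, w⟫_ℝ

lemma coe_re {n : ℕ} {q : E n → EReal} {x : E n} (hb : q x ≠ ⊥) (ht : q x ≠ ⊤) :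
    ((re q x : ℝ) : EReal) = q x := EReal.coe_toReal ht hb

/-- Fermat's rule for a minimizer of `q + H - ⟪s, ·⟫` with `H` differentiable. -/
lemma IsTiltedMin.sub_gradient_mem_regSubdiff {n : ℕ} {q : E n → EReal} {H : E n → ℝ} {s z : E n}
    (hbot : ∀ x, q x ≠ ⊥) (hH : DifferentiableAt ℝ H z) (h : IsTiltedMin q H s z) :
    s - gradient H z ∈ regSubdiff q z := by
  refine ⟨hbot z, h.1, fun ε hε => ?_⟩
  have h1 := hasGradientAt_iff_isLittleO.1 hH.hasGradientAt
  filter_upwards [h1.def hε] with y hy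
  rcases eq_or_ne (q y) ⊤ with hty | hty
  · simp [hty]
  · rw [← coe_re (hbot z) h.1, ← coe_re (hbot y) hty]
    norm_cast
    have h2 := h.2 y hty
    have h3 := (Real.le_norm_self _).trans hy
    rw [inner_sub_left, inner_sub_right s]
    linarith

/-- Minimizers of tilted costs are stable under limits, and the cost converges along them to its
value at the limit although it is only lower semicontinuous. -/
lemma IsTiltedMin.of_tendsto {n : ℕ} {q : E n → EReal} {H : E n → ℝ} {s z : ℕ → E n}
    {s₀ z₀ : E n} {r : ℝ} (hbot : ∀ x, q x ≠ ⊥) (hlsc : LowerSemicontinuous q) (hH : Continuous H)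
    (h : ∀ l, IsTiltedMin q H (s l) (z l)) (hs : Tendsto s atTop (𝓝 s₀))
    (hz : Tendsto z atTop (𝓝 z₀)) (hr : Tendsto (fun l => re q (z l)) atTop (𝓝 r)) :
    IsTiltedMin q H s₀ z₀ ∧ re q z₀ = r := by
  have hle : q z₀ ≤ (r : EReal) := by
    by_contra! hlt
    obtain ⟨c, hrc, hcq⟩ := EReal.lt_iff_exists_real_btwn.1 hlt
    have h1 := hz.eventually (hlsc z₀ c hcq)
    have h2 := hr.eventually (gt_mem_nhds (EReal.coe_lt_coe_iff.1 hrc))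
    obtain ⟨l, hl1, hl2⟩ := (h1.and h2).exists
    rw [← coe_re (hbot _) (h l).1] at hl1
    exact lt_asymm hl2 (EReal.coe_lt_coe_iff.1 hl1)
  have htop : q z₀ ≠ ⊤ := (hle.trans_lt (EReal.coe_lt_top r)).ne
  have hle' : re q z₀ ≤ r := by
    rw [← coe_re (hbot _) htop] at hle
    exact EReal.coe_le_coe_iff.1 hle
  have hlim : ∀ w, q w ≠ ⊤ → r + H z₀ - ⟪s₀, z₀⟫_ℝ ≤ re q w + H w - ⟪s₀, w⟫_ℝ := by
    intro w hw
    refine le_of_tendsto_of_tendsto ((hr.add ((hH.tendsto z₀).comp hz)).sub (hs.inner hz))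
      (tendsto_const_nhds.sub (hs.inner tendsto_const_nhds))
      (Eventually.of_forall fun l => (h l).2 w hw)
  have heq : re q z₀ = r := le_antisymm hle' (by linarith [hlim z₀ htop])
  exact ⟨⟨htop, fun w hw => by rw [heq]; exact hlim w hw⟩, heq⟩

lemma regSubdiff_subset_limSubdiff {n : ℕ} (q : E n → EReal) (x : E n) :
    regSubdiff q x ⊆ limSubdiff q x := fun v hv =>
  ⟨lt_top_iff_ne_top.2 hv.2.1, fun _ => x, fun _ => v, fun _ => hv, tendsto_const_nhds,
    tendsto_const_nhds, tendsto_const_nhds⟩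

/-! ### The kernels `hᵢ / γᵢ - fᵢ / N` -/

/-- The function `hᵢ / γᵢ - fᵢ / N`, whose gradient is `sEntry`. Adding these functions to the cost
gives the objective of the subproblem. -/
noncomputable def kernel {n N : ℕ} (f h : Fin N → E n → EReal) (γ : Fin N → ℝ) (i : Fin N) :
    E n → ℝ := fun x => (1 / γ i) * re (h i) x - (1 / N : ℝ) * re (f i) x

section
variable {n N : ℕ} {f h : Fin N → E n → EReal} {g : E n → EReal} {L γ : Fin N → ℝ} {θ : ℝ}

lemma contDiff_kernel (hKL : KLAssumption f h g θ) (i : Fin N) : ContDiff ℝ 2 (kernel f h γ i) :=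
  (contDiff_const.mul (hKL.h_C2 i).2).sub (contDiff_const.mul (hKL.f_C2 i).2)

lemma gradient_kernel (hKL : KLAssumption f h g θ) (i : Fin N) (x : E n) :
    gradient (kernel f h γ i) x = sEntry f h γ i x := by
  have hh := ((hKL.h_C2 i).2.differentiable (by norm_num) x).hasGradientAt
  have hf := ((hKL.f_C2 i).2.differentiable (by norm_num) x).hasGradientAt
  refine HasGradientAt.gradient ?_
  rw [hasGradientAt_iff_hasFDerivAt] at *
  rw [sEntry, map_sub, map_smul, map_smul]
  exact (hh.const_mul (1 / γ i)).sub (hf.const_mul (1 / N : ℝ))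

lemma gradient_sum_kernel (hKL : KLAssumption f h g θ) (x : E n) :
    gradient (fun x => ∑ i, kernel f h γ i x) x = ∑ i, sEntry f h γ i x := by
  refine HasGradientAt.gradient ?_
  rw [hasGradientAt_iff_hasFDerivAt, map_sum]
  refine HasFDerivAt.fun_sum fun i _ => ?_
  rw [← hasGradientAt_iff_hasFDerivAt, ← gradient_kernel hKL]
  exact ((contDiff_kernel hKL i).differentiable (by norm_num) x).hasGradientAt

lemma continuous_sEntry (hKL : KLAssumption f h g θ) (i : Fin N) :
    Continuous (sEntry f h γ i) := by
  have := (contDiff_gradient (contDiff_kernel (γ := γ) hKL i)).continuous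
  rwa [funext (gradient_kernel hKL i)] at this

lemma dom_eq_univ {q : E n → EReal} (hq : IsC2 q) : dom q = Set.univ :=
  Set.eq_univ_of_forall fun x => lt_top_iff_ne_top.2 (hq.1 x).2

/-- Relative smoothness and `γᵢ Lᵢ < N` bound the Bregman distance of `hᵢ / γᵢ - fᵢ / N` from below
by a positive multiple of that of `hᵢ`. -/
lemma le_bregman_kernel (hN : 0 < N) (hbasic : BasicAssumption f h g L γ)
    (hKL : KLAssumption f h g θ) (i : Fin N) (x y : E n) :
    (1 / γ i - L i / N) * bregman (re (h i)) x y ≤ bregman (kernel f h γ i) x y := by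
  have hN' : (0 : ℝ) < N := Nat.cast_pos.2 hN
  have hh := (hKL.h_C2 i).2.differentiable (by norm_num)
  have hf := (hKL.f_C2 i).2.differentiable (by norm_num)
  have hk := (contDiff_kernel (γ := γ) hKL i).differentiable (by norm_num)
  have hconv := (hbasic.relSmooth i).convex_sub
  rw [dom_eq_univ (hKL.h_C2 i), interior_univ] at hconv
  have h1 := bregman_nonneg_of_convexOn ((hh.const_mul (L i)).sub hf) hconv x y
  have e1 : fderiv ℝ (fun x => L i * re (h i) x - re (f i) x) y
      = L i • fderiv ℝ (re (h i)) y - fderiv ℝ (re (f i)) y :=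
    (((hh y).hasFDerivAt.const_mul (L i)).sub (hf y).hasFDerivAt).fderiv
  have e2 : fderiv ℝ (kernel f h γ i) y
      = (1 / γ i) • fderiv ℝ (re (h i)) y - (1 / N : ℝ) • fderiv ℝ (re (f i)) y :=
    (((hh y).hasFDerivAt.const_mul (1 / γ i)).sub ((hf y).hasFDerivAt.const_mul (1 / N : ℝ))).fderiv
  simp only [bregman, inner_gradient_left] at h1 ⊢
  change 0 ≤ (L i * re (h i) x - re (f i) x) - (L i * re (h i) y - re (f i) y)
    - fderiv ℝ (fun x => L i * re (h i) x - re (f i) x) y (x - y) at h1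
  rw [e1] at h1
  rw [e2]
  simp only [kernel, sub_apply, smul_apply, smul_eq_mul] at h1 ⊢
  have h2 := mul_nonneg (one_div_pos.2 hN').le h1
  have e3 : L i / N = 1 / N * L i := by ring
  rw [e3]
  linarith

/-- On a ball the Bregman distances of the kernels are strongly convex. -/
lemma exists_le_bregman_kernel (hN : 0 < N) (hbasic : BasicAssumption f h g L γ)
    (hKL : KLAssumption f h g θ) (R : ℝ) :
    ∃ m : ℝ, 0 < m ∧ ∀ i, ∀ x ∈ Metric.closedBall (0 : E n) R,
      ∀ y ∈ Metric.closedBall (0 : E n) R, m * ‖x - y‖ ^ 2 ≤ bregman (kernel f h γ i) x y := by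
  have hN' : (0 : ℝ) < N := Nat.cast_pos.2 hN
  have hpos : ∀ i, 0 < 1 / γ i - L i / N := fun i => by
    rw [sub_pos, div_lt_div_iff₀ hN' (hbasic.step_pos i)]
    linarith [hbasic.step_lt i]
  choose m hm hmb using fun i => exists_hessian_lower_bound (hKL.h_C2 i).2 (hKL.h_hessian i) R
  have : Nonempty (Fin N) := ⟨⟨0, hN⟩⟩
  obtain ⟨i₀, hi₀⟩ := Finite.exists_min fun i => (1 / γ i - L i / N) * (m i / 2)
  refine ⟨(1 / γ i₀ - L i₀ / N) * (m i₀ / 2), mul_pos (hpos _) (half_pos (hm _)),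
    fun i x hx y hy => ?_⟩
  have h1 := le_bregman_of_hessian_lower_bound (hKL.h_C2 i).2 (convex_closedBall _ _) (hmb i) hx hy
  calc _ ≤ (1 / γ i - L i / N) * (m i / 2) * ‖x - y‖ ^ 2 :=
        mul_le_mul_of_nonneg_right (hi₀ i) (sq_nonneg _)
    _ = (1 / γ i - L i / N) * (m i / 2 * ‖x - y‖ ^ 2) := by ring
    _ ≤ (1 / γ i - L i / N) * bregman (re (h i)) x y := mul_le_mul_of_nonneg_left h1 (hpos i).le
    _ ≤ _ := le_bregman_kernel hN hbasic hKL i x y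

lemma exists_sEntry_lipschitz (hN : 0 < N) (hKL : KLAssumption f h g θ) (R : ℝ) :
    ∃ Λ : ℝ, 0 < Λ ∧ ∀ i, ∀ x ∈ Metric.closedBall (0 : E n) R,
      ∀ y ∈ Metric.closedBall (0 : E n) R,
        ‖sEntry f h γ i x - sEntry f h γ i y‖ ≤ Λ * ‖x - y‖ := by
  choose Λ hΛ hb using fun i => exists_gradient_lipschitz (contDiff_kernel (γ := γ) hKL i) R
  have : Nonempty (Fin N) := ⟨⟨0, hN⟩⟩
  obtain ⟨i₀, hi₀⟩ := Finite.exists_max Λ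
  refine ⟨Λ i₀ + 1, by linarith [hΛ i₀], fun i x hx y hy => ?_⟩
  rw [← gradient_kernel hKL, ← gradient_kernel hKL]
  exact (hb i x hx y hy).trans
    (mul_le_mul_of_nonneg_right (by linarith [hi₀ i]) (norm_nonneg _))

lemma bregman_kernel_nonneg (hN : 0 < N) (hbasic : BasicAssumption f h g L γ)
    (hKL : KLAssumption f h g θ) (i : Fin N) (x y : E n) : 0 ≤ bregman (kernel f h γ i) x y := by
  obtain ⟨m, hm, hb⟩ := exists_le_bregman_kernel hN hbasic hKL (max ‖x‖ ‖y‖)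
  exact (mul_nonneg hm.le (sq_nonneg _)).trans (hb i x (by simp) y (by simp))

/-! ### The cost and the subproblem in real terms -/

lemma sum_coe_mul {q : Fin N → E n → EReal} (hq : ∀ i, IsC2 (q i)) (a : Fin N → ℝ) (x : E n) :
    ∑ i, ((a i : ℝ) : EReal) * q i x = ((∑ i, a i * re (q i) x : ℝ) : EReal) := by
  rw [show ((∑ i, a i * re (q i) x : ℝ) : EReal) = ∑ i, ((a i * re (q i) x : ℝ) : EReal) from
    map_sum (⟨⟨Real.toEReal, EReal.coe_zero⟩, EReal.coe_add⟩ : ℝ →+ EReal) _ _]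
  refine Finset.sum_congr rfl fun i _ => ?_
  rw [EReal.coe_mul, coe_re ((hq i).1 x).1 ((hq i).1 x).2]

lemma cost_eq (hKL : KLAssumption f h g θ) (x : E n) :
    cost f g x = ((1 / N * ∑ i, re (f i) x : ℝ) : EReal) + g x := by
  have := sum_coe_mul hKL.f_C2 (fun _ => 1) x
  simp only [EReal.coe_one, one_mul] at this
  rw [cost, this, ← EReal.coe_mul]

lemma cost_ne_bot (hbasic : BasicAssumption f h g L γ) (hKL : KLAssumption f h g θ) (x : E n) :
    cost f g x ≠ ⊥ := by
  rw [cost_eq hKL, ne_eq, EReal.add_eq_bot_iff, not_or]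
  exact ⟨EReal.coe_ne_bot _, hbasic.g_proper.1 x⟩

lemma cost_ne_top_iff (hKL : KLAssumption f h g θ) (x : E n) : cost f g x ≠ ⊤ ↔ g x ≠ ⊤ := by
  rw [cost_eq hKL]
  rcases eq_or_ne (g x) ⊤ with h1 | h1
  · simp only [h1, EReal.coe_add_top]
  · simp only [ne_eq, h1, not_false_eq_true, iff_true]
    exact EReal.add_ne_top (EReal.coe_ne_top _) h1

lemma subproblem_objective_eq (hbasic : BasicAssumption f h g L γ) (hKL : KLAssumption f h g θ)
    (s x : E n) (hx : g x ≠ ⊤) :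
    g x + ∑ i, ((1 / γ i : ℝ) : EReal) * h i x - ((⟪s, x⟫_ℝ : ℝ) : EReal)
      = ((re (cost f g) x + ∑ i, kernel f h γ i x - ⟪s, x⟫_ℝ : ℝ) : EReal) := by
  rw [sum_coe_mul hKL.h_C2, re, cost_eq hKL, ← coe_re (hbasic.g_proper.1 x) hx, ← EReal.coe_add,
    ← EReal.coe_add, ← EReal.coe_sub, EReal.toReal_coe]
  congr 1
  simp only [kernel, Finset.sum_sub_distrib, ← Finset.mul_sum]
  ring

lemma isTiltedMin_of_mem_subproblem (hbasic : BasicAssumption f h g L γ)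
    (hKL : KLAssumption f h g θ) {s z : E n} (hz : z ∈ subproblem h g γ s) :
    IsTiltedMin (cost f g) (fun x => ∑ i, kernel f h γ i x) s z := by
  obtain ⟨-, hlt, hmin⟩ := hz
  have hgz : g z ≠ ⊤ := by
    rintro h1
    simp only [h1, sum_coe_mul hKL.h_C2, EReal.top_add_coe, EReal.top_sub_coe, lt_self_iff_false]
      at hlt
  refine ⟨(cost_ne_top_iff hKL z).2 hgz, fun w hw => ?_⟩
  have hgw := (cost_ne_top_iff hKL w).1 hw
  have h1 := isMinOn_iff.1 hmin w (Set.mem_univ w)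
  rw [subproblem_objective_eq hbasic hKL s z hgz, subproblem_objective_eq hbasic hKL s w hgw] at h1
  exact EReal.coe_le_coe_iff.1 h1

/-- Up to a constant, tilting by the kernel gradients at points `yᵢ` is the same as adding the
Bregman distances to these points. -/
lemma IsTiltedMin.add_bregman_le (hKL : KLAssumption f h g θ) {y : Fin N → E n} {z w : E n}
    (hz : IsTiltedMin (cost f g) (fun x => ∑ i, kernel f h γ i x) (∑ i, sEntry f h γ i (y i)) z)
    (hw : cost f g w ≠ ⊤) :
    re (cost f g) z + ∑ i, bregman (kernel f h γ i) z (y i)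
      ≤ re (cost f g) w + ∑ i, bregman (kernel f h γ i) w (y i) := by
  have h1 := hz.2 w hw
  simp only [bregman, gradient_kernel hKL, inner_sub_right, Finset.sum_sub_distrib, sum_inner]
    at h1 ⊢
  linarith

end

/-! ### Epochs of the low-memory algorithm -/

/-- The point `table k i` at which `sEntry i` entered the vector `s k`. -/
noncomputable def table {n N : ℕ} (xinit : E n) (z : ℕ → E n) (I : ℕ → Finset (Fin N)) :
    ℕ → Fin N → E n
  | 0, _ => xinit
  | k + 1, i => if i ∈ I (k + 1) then z k else table xinit z I k i

/-- What holds at an iteration `k` of the epoch that starts with the full update `k₀`; an index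
leaves `K` when its table entry is updated. -/
structure InEpoch {n N : ℕ} (f h : Fin N → E n → EReal) (g : E n → EReal) (γ : Fin N → ℝ)
    (z zt : ℕ → E n) (K : ℕ → Finset (Fin N)) (y : ℕ → Fin N → E n) (k₀ k : ℕ) : Prop where
  lt : k₀ < k
  card_add_le : (K k).card + k ≤ k₀ + N + 1
  zt_eq : ∀ m, k₀ ≤ m → m < k → zt m = z k₀
  table_eq : ∀ i ∈ K k, y k i = z k₀
  table_mem : ∀ i, cost f g (y k i) ≠ ⊤ ∧ re (cost f g) (y k i) ≤ re (cost f g) (z k₀)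
  descent : re (cost f g) (z k) + ∑ i, bregman (kernel f h γ i) (z k) (y k i)
    + ∑ i ∈ (K k)ᶜ, bregman (kernel f h γ i) (y k i) (z k₀) ≤ re (cost f g) (z k₀)

section
variable {n N : ℕ} {f h : Fin N → E n → EReal} {g : E n → EReal} {L γ : Fin N → ℝ} {θ : ℝ}
  {xinit : E n} {s z zt : ℕ → E n} {I K : ℕ → Finset (Fin N)}

lemma table_succ_of_mem {k : ℕ} {i : Fin N} (hi : i ∈ I (k + 1)) :
    table xinit z I (k + 1) i = z k := if_pos hi

lemma table_succ_of_notMem {k : ℕ} {i : Fin N} (hi : i ∉ I (k + 1)) :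
    table xinit z I (k + 1) i = table xinit z I k i := if_neg hi

/-- The vector `s k` is the sum of the gradients at the table entries, and the entries that are
still to be updated in the current epoch are those of the last full update. -/
lemma IsLowMemoryRun.s_eq (hrun : IsLowMemoryRun f h g γ xinit s z zt I K) (k : ℕ) :
    s k = ∑ i, sEntry f h γ i (table xinit z I k i) ∧
      ∀ i ∈ K k, table xinit z I k i = zt (k - 1) := by
  induction k with
  | zero => exact ⟨hrun.s_zero, by simp [hrun.K_zero]⟩
  | succ k ih =>
    by_cases hK : K k = ∅
    · obtain ⟨hI, -, hzt, hs⟩ := hrun.full k hK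
      have ht : ∀ i, table xinit z I (k + 1) i = z k := fun i =>
        table_succ_of_mem (by simp [hI])
      exact ⟨by simp only [hs, ht], fun i _ => by rw [ht, Nat.add_sub_cancel, hzt]⟩
    · obtain ⟨-, hIK, hKs, hzt, hs⟩ := hrun.incremental k hK
      constructor
      · rw [hs, ih.1, ← Finset.sum_add_sum_compl (I (k + 1)),
          ← Finset.sum_add_sum_compl (I (k + 1)) fun i => sEntry f h γ i (table xinit z I (k + 1) i)]
        have h1 : ∑ i ∈ I (k + 1), sEntry f h γ i (table xinit z I (k + 1) i)
            = ∑ i ∈ I (k + 1), sEntry f h γ i (z k) :=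
          Finset.sum_congr rfl fun i hi => by rw [table_succ_of_mem hi]
        have h2 : ∑ i ∈ (I (k + 1))ᶜ, sEntry f h γ i (table xinit z I (k + 1) i)
            = ∑ i ∈ (I (k + 1))ᶜ, sEntry f h γ i (table xinit z I k i) :=
          Finset.sum_congr rfl fun i hi => by
            rw [table_succ_of_notMem (Finset.mem_compl.1 hi)]
        have h3 : ∑ i ∈ I (k + 1), sEntry f h γ i (table xinit z I k i)
            = ∑ i ∈ I (k + 1), sEntry f h γ i (zt k) :=
          Finset.sum_congr rfl fun i hi => by rw [ih.2 i (hIK hi), hzt]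
        rw [h1, h2, h3, Finset.sum_sub_distrib]
        abel
      · intro i hi
        rw [hKs, Finset.mem_sdiff] at hi
        rw [table_succ_of_notMem hi.2, ih.2 i hi.1, Nat.add_sub_cancel, hzt]

lemma IsLowMemoryRun.isTiltedMin (hrun : IsLowMemoryRun f h g γ xinit s z zt I K)
    (hbasic : BasicAssumption f h g L γ) (hKL : KLAssumption f h g θ) (k : ℕ) :
    IsTiltedMin (cost f g) (fun x => ∑ i, kernel f h γ i x)
      (∑ i, sEntry f h γ i (table xinit z I k i)) (z k) := by
  rw [← (hrun.s_eq k).1]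
  exact isTiltedMin_of_mem_subproblem hbasic hKL (hrun.z_mem k)

/-- The value `φ(zᵏ) + ∑ᵢ Dᵢ(zᵏ, yᵢᵏ)` of the subproblem drops by the Bregman distances of the
updated entries. -/
lemma IsLowMemoryRun.value_descent (hrun : IsLowMemoryRun f h g γ xinit s z zt I K)
    (hbasic : BasicAssumption f h g L γ) (hKL : KLAssumption f h g θ) (k : ℕ) :
    re (cost f g) (z (k + 1))
        + ∑ i, bregman (kernel f h γ i) (z (k + 1)) (table xinit z I (k + 1) i)
        + ∑ i ∈ I (k + 1), bregman (kernel f h γ i) (z k) (table xinit z I k i)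
      ≤ re (cost f g) (z k) + ∑ i, bregman (kernel f h γ i) (z k) (table xinit z I k i) := by
  have h1 := (hrun.isTiltedMin hbasic hKL (k + 1)).add_bregman_le hKL
    (hrun.isTiltedMin hbasic hKL k).1
  have h2 : ∑ i, bregman (kernel f h γ i) (z k) (table xinit z I (k + 1) i)
      = ∑ i ∈ (I (k + 1))ᶜ, bregman (kernel f h γ i) (z k) (table xinit z I k i) := by
    rw [← Finset.sum_add_sum_compl (I (k + 1)),
      Finset.sum_eq_zero fun i hi => by rw [table_succ_of_mem hi, bregman_self], zero_add]
    exact Finset.sum_congr rfl fun i hi => by rw [table_succ_of_notMem (Finset.mem_compl.1 hi)]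
  rw [h2] at h1
  rw [← Finset.sum_add_sum_compl (I (k + 1)) fun i =>
    bregman (kernel f h γ i) (z k) (table xinit z I k i)]
  linarith

lemma IsLowMemoryRun.inEpoch_start (hrun : IsLowMemoryRun f h g γ xinit s z zt I K)
    (hbasic : BasicAssumption f h g L γ) (hKL : KLAssumption f h g θ) {k₀ : ℕ} (hK : K k₀ = ∅) :
    InEpoch f h g γ z zt K (table xinit z I) k₀ (k₀ + 1) := by
  obtain ⟨hI, hK1, hzt, -⟩ := hrun.full k₀ hK
  have ht : ∀ i, table xinit z I (k₀ + 1) i = z k₀ := fun i => table_succ_of_mem (by simp [hI])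
  have hmin := (hrun.isTiltedMin hbasic hKL k₀).1
  refine ⟨k₀.lt_succ_self, by simp [hK1]; omega, fun m h1 h2 => ?_, fun i _ => ht i,
    fun i => by rw [ht]; exact ⟨hmin, le_rfl⟩, ?_⟩
  · rw [show m = k₀ by omega, hzt]
  · have := hrun.value_descent hbasic hKL k₀
    simp only [hI] at this
    simp only [hK1, Finset.compl_univ, Finset.sum_empty]
    linarith

lemma IsLowMemoryRun.inEpoch_succ (hrun : IsLowMemoryRun f h g γ xinit s z zt I K) (hN : 0 < N)
    (hbasic : BasicAssumption f h g L γ) (hKL : KLAssumption f h g θ) {k₀ k : ℕ}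
    (he : InEpoch f h g γ z zt K (table xinit z I) k₀ k) (hK : K k ≠ ∅) :
    InEpoch f h g γ z zt K (table xinit z I) k₀ (k + 1) := by
  obtain ⟨hne, hIK, hKs, hzt, -⟩ := hrun.incremental k hK
  have hlt := he.lt
  have hztk : zt k = z k₀ := by rw [hzt]; exact he.zt_eq _ (by omega) (by omega)
  have hval : re (cost f g) (z k) ≤ re (cost f g) (z k₀) := by
    have h1 := Finset.sum_nonneg fun i (_ : i ∈ Finset.univ) =>
      bregman_kernel_nonneg hN hbasic hKL i (z k) (table xinit z I k i)
    have h2 := Finset.sum_nonneg fun i (_ : i ∈ (K k)ᶜ) =>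
      bregman_kernel_nonneg hN hbasic hKL i (table xinit z I k i) (z k₀)
    linarith [he.descent]
  refine ⟨by omega, ?_, fun m h1 h2 => ?_, fun i hi => ?_, fun i => ?_, ?_⟩
  · have h1 : (K (k + 1)).card < (K k).card := by
      rw [hKs]
      exact Finset.card_lt_card (Finset.sdiff_ssubset hIK hne)
    have := he.card_add_le
    omega
  · rcases Nat.lt_succ_iff_lt_or_eq.1 h2 with h3 | rfl
    · exact he.zt_eq m h1 h3
    · exact hztk
  · rw [hKs, Finset.mem_sdiff] at hi
    rw [table_succ_of_notMem hi.2, he.table_eq i hi.1]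
  · by_cases hi : i ∈ I (k + 1)
    · rw [table_succ_of_mem hi]
      exact ⟨(hrun.isTiltedMin hbasic hKL k).1, hval⟩
    · rw [table_succ_of_notMem hi]
      exact he.table_mem i
  · have h1 := hrun.value_descent hbasic hKL k
    have h2 : (K (k + 1))ᶜ = (K k)ᶜ ∪ I (k + 1) := by
      ext i
      simp only [hKs, Finset.mem_compl, Finset.mem_sdiff, Finset.mem_union]
      tauto
    have h3 : Disjoint (K k)ᶜ (I (k + 1)) :=
      Finset.disjoint_left.2 fun i hi hi' => Finset.mem_compl.1 hi (hIK hi')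
    have h4 : ∑ i ∈ (K k)ᶜ, bregman (kernel f h γ i) (table xinit z I (k + 1) i) (z k₀)
        = ∑ i ∈ (K k)ᶜ, bregman (kernel f h γ i) (table xinit z I k i) (z k₀) :=
      Finset.sum_congr rfl fun i hi => by
        rw [table_succ_of_notMem (Finset.disjoint_left.1 h3 hi)]
    have h5 : ∑ i ∈ I (k + 1), bregman (kernel f h γ i) (table xinit z I (k + 1) i) (z k₀)
        = ∑ i ∈ I (k + 1), bregman (kernel f h γ i) (z k) (table xinit z I k i) :=
      Finset.sum_congr rfl fun i hi => by rw [table_succ_of_mem hi, he.table_eq i (hIK hi)]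
    rw [h2, Finset.sum_union h3, h4, h5]
    linarith [he.descent]

lemma IsLowMemoryRun.exists_epoch_end (hrun : IsLowMemoryRun f h g γ xinit s z zt I K)
    (hN : 0 < N) (hbasic : BasicAssumption f h g L γ) (hKL : KLAssumption f h g θ) {k₀ : ℕ}
    (hK : K k₀ = ∅) :
    ∃ k, K k = ∅ ∧ InEpoch f h g γ z zt K (table xinit z I) k₀ k := by
  by_contra! hcon
  have hall : ∀ m, InEpoch f h g γ z zt K (table xinit z I) k₀ (k₀ + 1 + m) := by
    intro m
    induction m with
    | zero => exact hrun.inEpoch_start hbasic hKL hK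
    | succ m ih => exact hrun.inEpoch_succ hN hbasic hKL ih fun h => hcon _ h ih
  -- every iteration of the epoch removes an index from `K`
  have := (hall (N + 1)).card_add_le
  omega

/-- The starting times of the epochs; an epoch takes at most `N + 1` iterations. -/
lemma IsLowMemoryRun.exists_epochs (hrun : IsLowMemoryRun f h g γ xinit s z zt I K) (hN : 0 < N)
    (hbasic : BasicAssumption f h g L γ) (hKL : KLAssumption f h g θ) :
    ∃ t : ℕ → ℕ,
      (∀ j, K (t j) = ∅ ∧ InEpoch f h g γ z zt K (table xinit z I) (t j) (t (j + 1))) ∧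
      ∀ k, ∃ j, zt k = z (t j) ∧ k + 1 ≤ (j + 1) * (N + 1) := by
  choose! next hnext using fun k₀ (hK : K k₀ = ∅) => hrun.exists_epoch_end hN hbasic hKL hK
  have hKt : ∀ j, K (next^[j] 0) = ∅ := by
    intro j
    induction j with
    | zero => exact hrun.K_zero
    | succ j ih => rw [Function.iterate_succ_apply']; exact (hnext _ ih).1
  have hep : ∀ j, InEpoch f h g γ z zt K (table xinit z I) (next^[j] 0) (next^[j + 1] 0) :=
    fun j => by rw [Function.iterate_succ_apply']; exact (hnext _ (hKt j)).2
  refine ⟨fun j => next^[j] 0, fun j => ⟨hKt j, hep j⟩, fun k => ?_⟩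
  have hle : ∀ j, next^[j] 0 ≤ j * (N + 1) := by
    intro j
    induction j with
    | zero => simp
    | succ j ih =>
      have := (hep j).card_add_le
      rw [add_mul]
      omega
  obtain ⟨j, h1, h2⟩ : ∃ j, next^[j] 0 ≤ k ∧ k < next^[j + 1] 0 := by
    induction k with
    | zero => exact ⟨0, le_rfl, (hep 0).lt⟩
    | succ k ih =>
      obtain ⟨j, h1, h2⟩ := ih
      by_cases h3 : k + 1 < next^[j + 1] 0
      · exact ⟨j, by omega, h3⟩
      · exact ⟨j + 1, by omega, by have := (hep (j + 1)).lt; omega⟩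
  exact ⟨j, (hep j).zt_eq k h1 h2, h2.trans_le (hle (j + 1))⟩

end

/-! ### Geometric rates of the iterates -/

/-- The linear rate of the cost passes to the iterates through the tail bound of `tendsto_of_KL`. -/
lemma exists_geometric_bound_dist {d δ Δ : ℕ → ℝ} {θ a κ c ρ : ℝ} (hθ : θ ≤ 1 / 2) (ha : 0 < a)
    (hκ : 0 ≤ κ) (hδ0 : ∀ j, 0 ≤ δ j) (hδ : Tendsto δ atTop (𝓝 0))
    (hdesc : ∀ j, a * Δ j ^ 2 ≤ δ j - δ (j + 1)) (hc0 : 0 < c) (hc1 : c < 1)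
    (hb : ∀ m, δ m ≤ ρ * c ^ m)
    (hd : ∀ᶠ m in atTop, d (m + 1) ≤ Δ m + κ * δ (m + 1) ^ (1 - θ)) :
    ∃ c ρ : ℝ, 0 < c ∧ c < 1 ∧ 0 < ρ ∧ ∀ m, d m ≤ ρ * c ^ m := by
  have hsc : 0 < √c := Real.sqrt_pos.2 hc0
  have hρ : 0 ≤ ρ := by simpa using (hδ0 0).trans (hb 0)
  set B := (√a)⁻¹ + κ with hB
  have hB0 : 0 ≤ B := by positivity
  have h1 : ∀ᶠ m in atTop, d (m + 1) ≤ B * √ρ / √c * √c ^ (m + 1) := by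
    filter_upwards [hd, (hδ.comp (tendsto_add_atTop_nat 1)).eventually (gt_mem_nhds one_pos)]
      with m hm hm1
    have hdec : δ (m + 1) ≤ δ m := by nlinarith [hdesc m, sq_nonneg (Δ m)]
    have e1 : Δ m ≤ (√a)⁻¹ * √(δ m) := by
      rw [inv_mul_eq_div, ← Real.sqrt_div' _ ha.le]
      refine Real.le_sqrt_of_sq_le ?_
      rw [le_div_iff₀ ha]
      linarith [hdesc m, hδ0 (m + 1)]
    have e2 : δ (m + 1) ^ (1 - θ) ≤ √(δ m) := by
      refine le_trans ?_ (Real.sqrt_le_sqrt hdec)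
      rcases (hδ0 (m + 1)).eq_or_lt with h0 | h0
      · rw [← h0, Real.zero_rpow (by linarith), Real.sqrt_zero]
      · rw [Real.sqrt_eq_rpow]
        exact Real.rpow_le_rpow_of_exponent_ge h0 hm1.le (by linarith)
    have e3 : √(δ m) ≤ √ρ * √c ^ m := by
      refine Real.sqrt_le_iff.2 ⟨by positivity, (hb m).trans_eq ?_⟩
      rw [mul_pow, Real.sq_sqrt hρ, ← pow_mul, mul_comm m, pow_mul, Real.sq_sqrt hc0.le]
    have e4 := mul_le_mul_of_nonneg_left e2 hκ
    have e5 := mul_le_mul_of_nonneg_left e3 hB0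
    have e6 : B * √ρ / √c * √c ^ (m + 1) = B * (√ρ * √c ^ m) := by
      rw [pow_succ]; field_simp
    have e7 : B * √(δ m) = (√a)⁻¹ * √(δ m) + κ * √(δ m) := by rw [hB]; ring
    linarith
  have h2 : ∀ᶠ m in atTop, d m ≤ B * √ρ / √c * √c ^ m := by
    obtain ⟨J, hJ⟩ := eventually_atTop.1 h1
    refine eventually_atTop.2 ⟨J + 1, fun m hm => ?_⟩
    obtain ⟨k, rfl⟩ : ∃ k, m = k + 1 := ⟨m - 1, by omega⟩
    exact hJ k (by omega)
  obtain ⟨ρ', hρ', hb'⟩ := exists_forall_le_mul_of_eventually (fun m => pow_pos hsc m) h2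
  exact ⟨√c, ρ', hsc, by rw [Real.sqrt_lt' one_pos]; simpa using hc1, hρ', hb'⟩

/-- A geometric bound in the number of epochs is a geometric bound in the number of iterations,
with ratio `c ^ (1 / (N + 1))`. -/
lemma exists_geometric_bound_of_epochs {u w : ℕ → ℝ} {j : ℕ → ℕ} {N : ℕ}
    (hu : ∀ k, u k = w (j k)) (hj : ∀ k, k + 1 ≤ (j k + 1) * (N + 1))
    (h : ∃ c ρ : ℝ, 0 < c ∧ c < 1 ∧ 0 < ρ ∧ ∀ m, w m ≤ ρ * c ^ m) :
    ∃ c ρ : ℝ, 0 < c ∧ c < 1 ∧ 0 < ρ ∧ ∀ k, u k ≤ ρ * c ^ k := by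
  obtain ⟨c, ρ, hc0, hc1, hρ, hb⟩ := h
  set c' := c ^ (((N + 1 : ℕ) : ℝ)⁻¹) with hc'
  have hc'0 : 0 < c' := Real.rpow_pos_of_pos hc0 _
  have hc'1 : c' < 1 := Real.rpow_lt_one hc0.le hc1 (by positivity)
  have hpow : c' ^ (N + 1) = c := Real.rpow_inv_natCast_pow hc0.le (by omega)
  refine ⟨c', ρ / c' ^ N, hc'0, hc'1, by positivity, fun k => ?_⟩
  rw [hu]
  refine (hb (j k)).trans ?_
  rw [div_mul_eq_mul_div, le_div_iff₀ (pow_pos hc'0 N), mul_assoc, ← hpow, ← pow_mul, ← pow_add]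
  refine mul_le_mul_of_nonneg_left (pow_le_pow_of_le_one hc'0.le hc'1.le ?_) hρ.le
  have h1 := hj k
  have h2 : (j k + 1) * (N + 1) = (N + 1) * j k + N + 1 := by ring
  omega

/-! ### Convergence of the epoch sequence -/

/-- Consecutive epoch points with the intermediate points `Y j i`: sufficient decrease and
optimality give the finite length argument, first along a convergent subsequence and then, by
the KL inequality, for the whole sequence. -/
theorem exists_limit_of_descent {n N : ℕ} (hN : 0 < N) {f h : Fin N → E n → EReal}
    {g : E n → EReal} {L γ : Fin N → ℝ} {θ : ℝ} (hbasic : BasicAssumption f h g L γ)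
    (hKL : KLAssumption f h g θ) {x : ℕ → E n} {Y : ℕ → Fin N → E n}
    (hfin : ∀ j, cost f g (x j) ≠ ⊤)
    (hY : ∀ j i, cost f g (Y j i) ≠ ⊤ ∧ re (cost f g) (Y j i) ≤ re (cost f g) (x j))
    (hmin : ∀ j, IsTiltedMin (cost f g) (fun x => ∑ i, kernel f h γ i x)
      (∑ i, sEntry f h γ i (Y j i)) (x (j + 1)))
    (hdesc : ∀ j, re (cost f g) (x (j + 1))
      + ∑ i, bregman (kernel f h γ i) (x (j + 1)) (Y j i)
      + ∑ i, bregman (kernel f h γ i) (Y j i) (x j) ≤ re (cost f g) (x j)) :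
    ∃ x₀, IsStationaryPt (cost f g) x₀ ∧ Tendsto x atTop (𝓝 x₀) ∧
      (∀ j, re (cost f g) x₀ ≤ re (cost f g) (x j)) ∧
      (1 / 2 < θ → ∃ c : ℝ, 0 < c ∧ ∀ m : ℕ,
        re (cost f g) (x m) - re (cost f g) x₀ ≤ c * ((m : ℝ) + 1) ^ (-(1 / (2 * θ - 1)))) ∧
      (θ ≤ 1 / 2 → (∃ c ρ : ℝ, 0 < c ∧ c < 1 ∧ 0 < ρ ∧ ∀ m, dist (x m) x₀ ≤ ρ * c ^ m) ∧
        ∃ c ρ : ℝ, 0 < c ∧ c < 1 ∧ 0 < ρ ∧ ∀ m,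
          re (cost f g) (x m) - re (cost f g) x₀ ≤ ρ * c ^ m) := by
  have hN' : (0 : ℝ) < N := Nat.cast_pos.2 hN
  have hbot := cost_ne_bot hbasic hKL
  set F := re (cost f g) with hF
  set H : E n → ℝ := fun x => ∑ i, kernel f h γ i x with hH
  have hHdiff : Differentiable ℝ H := Differentiable.fun_sum fun i _ =>
    (contDiff_kernel hKL i).differentiable (by norm_num)
  have hanti : Antitone fun j => F (x j) := antitone_nat_of_succ_le fun j => by
    have h1 := Finset.sum_nonneg fun i (_ : i ∈ Finset.univ) =>
      bregman_kernel_nonneg hN hbasic hKL i (x (j + 1)) (Y j i)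
    have h2 := Finset.sum_nonneg fun i (_ : i ∈ Finset.univ) =>
      bregman_kernel_nonneg hN hbasic hKL i (Y j i) (x j)
    linarith [hdesc j]
  -- level boundedness: all points lie in a ball, on which the kernels are strongly convex with
  -- Lipschitz gradients
  obtain ⟨R, hR⟩ := (hKL.levelBounded (F (x 0))).subset_closedBall 0
  have hball : ∀ w, cost f g w ≠ ⊤ → F w ≤ F (x 0) → w ∈ Metric.closedBall (0 : E n) R :=
    fun w hw hle => hR (by
      change cost f g w ≤ _
      rw [← coe_re (hbot w) hw]
      exact EReal.coe_le_coe_iff.2 hle)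
  have hxR : ∀ j, x j ∈ Metric.closedBall (0 : E n) R := fun j =>
    hball _ (hfin j) (hanti (Nat.zero_le j))
  have hYR : ∀ j i, Y j i ∈ Metric.closedBall (0 : E n) R := fun j i =>
    hball _ (hY j i).1 ((hY j i).2.trans (hanti (Nat.zero_le j)))
  obtain ⟨m, hm, hmb⟩ := exists_le_bregman_kernel hN hbasic hKL R
  obtain ⟨Λ, hΛ, hΛb⟩ := exists_sEntry_lipschitz (γ := γ) hN hKL R
  set Δ : ℕ → ℝ := fun j => ∑ i, (‖x (j + 1) - Y j i‖ + ‖Y j i - x j‖) with hΔ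
  have hΔ0 : ∀ j, 0 ≤ Δ j := fun j =>
    Finset.sum_nonneg fun i _ => add_nonneg (norm_nonneg _) (norm_nonneg _)
  have hΔi : ∀ j i, ‖x (j + 1) - Y j i‖ + ‖Y j i - x j‖ ≤ Δ j := fun j i =>
    Finset.single_le_sum (f := fun i => ‖x (j + 1) - Y j i‖ + ‖Y j i - x j‖)
      (fun i _ => add_nonneg (norm_nonneg _) (norm_nonneg _)) (Finset.mem_univ i)
  set a := m / (2 * N) with ha'
  have ha : 0 < a := by positivity
  have hdec : ∀ j, a * Δ j ^ 2 ≤ F (x j) - F (x (j + 1)) := by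
    intro j
    have h1 : Δ j ^ 2 ≤ N * ∑ i, (‖x (j + 1) - Y j i‖ + ‖Y j i - x j‖) ^ 2 := by
      simpa using sq_sum_le_card_mul_sum_sq (s := (Finset.univ : Finset (Fin N)))
        (f := fun i => ‖x (j + 1) - Y j i‖ + ‖Y j i - x j‖)
    have h2 : m / 2 * ∑ i, (‖x (j + 1) - Y j i‖ + ‖Y j i - x j‖) ^ 2
        ≤ ∑ i, bregman (kernel f h γ i) (x (j + 1)) (Y j i)
          + ∑ i, bregman (kernel f h γ i) (Y j i) (x j) := by
      rw [Finset.mul_sum, ← Finset.sum_add_distrib]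
      refine Finset.sum_le_sum fun i _ => ?_
      have h3 := hmb i _ (hxR (j + 1)) _ (hYR j i)
      have h4 := hmb i _ (hYR j i) _ (hxR j)
      have h5 := mul_nonneg hm.le (sq_nonneg (‖x (j + 1) - Y j i‖ - ‖Y j i - x j‖))
      linarith
    have h6 := mul_le_mul_of_nonneg_left h1 ha.le
    have h7 : a * (N * ∑ i, (‖x (j + 1) - Y j i‖ + ‖Y j i - x j‖) ^ 2)
        = m / 2 * ∑ i, (‖x (j + 1) - Y j i‖ + ‖Y j i - x j‖) ^ 2 := by
      rw [ha']; field_simp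
    linarith [hdesc j]
  -- the cost is bounded below by the value of the assumed solution, as `C` is the whole space
  obtain ⟨w₀, -, hw₀top, hw₀⟩ := hbasic.solution
  have hC : closure (domC h) = Set.univ := by
    have : domC h = Set.univ := by simp [domC, dom_eq_univ (hKL.h_C2 _)]
    rw [this, closure_univ]
  rw [hC] at hw₀
  have hbelow : ∀ j, F w₀ ≤ F (x j) := fun j => by
    have h1 := isMinOn_iff.1 hw₀ (x j) (Set.mem_univ _)
    rw [← coe_re (hbot _) hw₀top.ne, ← coe_re (hbot _) (hfin j)] at h1
    exact EReal.coe_le_coe_iff.1 h1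
  obtain ⟨r, hr⟩ : ∃ r, Tendsto (fun j => F (x j)) atTop (𝓝 r) :=
    ⟨_, tendsto_atTop_ciInf hanti ⟨F w₀, by rintro _ ⟨j, rfl⟩; exact hbelow j⟩⟩
  have hrle : ∀ j, r ≤ F (x j) := hanti.le_of_tendsto hr
  have hΔlim : Tendsto Δ atTop (𝓝 0) := by
    have h3 : Tendsto (fun j => √((F (x j) - r) / a)) atTop (𝓝 0) := by
      simpa using ((hr.sub_const r).div_const a).sqrt
    refine squeeze_zero hΔ0 (fun j => Real.le_sqrt_of_sq_le ?_) h3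
    rw [le_div_iff₀ ha]
    linarith [hdec j, hrle (j + 1)]
  -- along a convergent subsequence the intermediate points converge to the same limit, and the
  -- optimality condition survives
  obtain ⟨x₀, -, σ, hσ, hσx⟩ := (isCompact_closedBall (0 : E n) R).tendsto_subseq
    fun j => hxR (j + 1)
  have hσY : ∀ i, Tendsto (fun l => Y (σ l) i) atTop (𝓝 x₀) := fun i => by
    refine tendsto_of_tendsto_of_dist hσx
      (squeeze_zero (fun _ => dist_nonneg) (fun l => ?_) (hΔlim.comp hσ.tendsto_atTop))
    simp only [Function.comp_apply, dist_eq_norm]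
    linarith [hΔi (σ l) i, norm_nonneg (Y (σ l) i - x (σ l))]
  obtain ⟨hmin₀, hFx₀⟩ := IsTiltedMin.of_tendsto (r := r) (s₀ := ∑ i, sEntry f h γ i x₀) hbot
    hKL.kl.2.1 hHdiff.continuous (fun l => hmin (σ l))
    (tendsto_finsetSum _ fun i _ => ((continuous_sEntry hKL i).tendsto x₀).comp (hσY i)) hσx
    (hr.comp ((tendsto_add_atTop_nat 1).comp hσ.tendsto_atTop))
  change F x₀ = r at hFx₀
  have hstat : IsStationaryPt (cost f g) x₀ := by
    have := hmin₀.sub_gradient_mem_regSubdiff hbot (hHdiff x₀)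
    rwa [hH, gradient_sum_kernel hKL, sub_self] at this
  obtain ⟨ε, η, ϱ, hε, hη, hϱ, hkl⟩ := hKL.kl.2.2 x₀ ⟨0, regSubdiff_subset_limSubdiff _ _ hstat⟩
  have hθ0 := hKL.theta_pos
  have hθ1 := hKL.theta_lt_one
  set C := ϱ * (1 - θ) * Λ with hC'
  have hC0 : 0 < C := mul_pos (mul_pos hϱ (by linarith)) hΛ
  set δ : ℕ → ℝ := fun j => F (x j) - F x₀ with hδ'
  have hδ0 : ∀ j, 0 ≤ δ j := fun j => sub_nonneg.2 (hFx₀ ▸ hrle j)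
  have hδ : Tendsto δ atTop (𝓝 0) := by
    have := hr.sub_const r
    rw [sub_self] at this
    simpa only [hδ', hFx₀] using this
  have hdec' : ∀ j, a * Δ j ^ 2 ≤ δ j - δ (j + 1) := fun j => by
    simp only [hδ']; linarith [hdec j]
  have hdist : ∀ j, dist (x j) (x (j + 1)) ≤ Δ j := fun j => by
    refine le_trans ?_ (hΔi j ⟨0, hN⟩)
    rw [dist_comm, dist_eq_norm]
    exact norm_sub_le_norm_sub_add_norm_sub _ _ _
  have hclus : MapClusterPt x₀ atTop x :=
    MapClusterPt.of_comp ((tendsto_add_atTop_nat 1).comp hσ.tendsto_atTop)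
      (Tendsto.mapClusterPt hσx)
  -- optimality of `x (j + 1)` provides the subgradient to which the KL inequality is applied
  have hKLx : ∀ j, dist (x (j + 1)) x₀ < ε → 0 < δ (j + 1) → δ (j + 1) < η →
      δ (j + 1) ^ θ ≤ C * Δ j := by
    intro j h1 h2 h3
    have hv := (hmin j).sub_gradient_mem_regSubdiff hbot (hHdiff (x (j + 1)))
    rw [hH, gradient_sum_kernel hKL, ← Finset.sum_sub_distrib] at hv
    set v := ∑ i, (sEntry f h γ i (Y j i) - sEntry f h γ i (x (j + 1))) with hvdef
    have hvn : ‖v‖ ≤ Λ * Δ j := by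
      rw [hvdef, hΔ, Finset.mul_sum]
      refine (norm_sum_le _ _).trans (Finset.sum_le_sum fun i _ => ?_)
      refine (hΛb i _ (hYR j i) _ (hxR (j + 1))).trans
        (mul_le_mul_of_nonneg_left ?_ hΛ.le)
      rw [norm_sub_rev]
      linarith [norm_nonneg (Y j i - x j)]
    have h4 : 1 ≤ ϱ * (1 - θ) * δ (j + 1) ^ (-θ) * ‖v‖ := by
      refine hkl (x (j + 1)) (by rwa [← dist_eq_norm]) ?_ ?_ v
        (regSubdiff_subset_limSubdiff _ _ hv)
      · rw [← coe_re (hbot _) hmin₀.1, ← coe_re (hbot _) (hfin (j + 1))]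
        exact EReal.coe_lt_coe_iff.2 (sub_pos.1 h2)
      · rw [← coe_re (hbot _) hmin₀.1, ← coe_re (hbot _) (hfin (j + 1)), ← EReal.coe_add]
        exact EReal.coe_lt_coe_iff.2 (sub_lt_iff_lt_add'.1 h3)
    have hpos := Real.rpow_pos_of_pos h2 θ
    rw [Real.rpow_neg h2.le, mul_assoc, mul_comm (_⁻¹), ← mul_assoc, ← div_eq_mul_inv,
      one_le_div hpos] at h4
    refine h4.trans ?_
    rw [hC', mul_assoc _ Λ]
    exact mul_le_mul_of_nonneg_left hvn (mul_pos hϱ (by linarith)).le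
  obtain ⟨hlim, hev⟩ := tendsto_of_KL hθ0 hθ1 ha hC0.le hε hη hΔ0 hδ0 hδ hdec' hdist hclus hKLx
  have hrate : ∀ᶠ j in atTop, δ (j + 1) ^ (2 * θ) ≤ C ^ 2 / a * (δ j - δ (j + 1)) := by
    filter_upwards [hev] with j hj
    have h1 : δ (j + 1) ^ (2 * θ) = (δ (j + 1) ^ θ) ^ 2 := by
      rw [mul_comm, Real.rpow_mul (hδ0 _)]; norm_cast
    have h2 : (δ (j + 1) ^ θ) ^ 2 ≤ (C * Δ j) ^ 2 :=
      pow_le_pow_left₀ (Real.rpow_nonneg (hδ0 _) _) hj.1 2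
    have h3 := mul_le_mul_of_nonneg_left (hdec' j) (by positivity : 0 ≤ C ^ 2 / a)
    have h4 : C ^ 2 / a * (a * Δ j ^ 2) = (C * Δ j) ^ 2 := by field_simp
    linarith
  have hA : 0 < C ^ 2 / a := by positivity
  refine ⟨x₀, hstat, hlim, fun j => hFx₀ ▸ hrle j,
    fun hθ => exists_polynomial_bound hθ hθ1 hA hrate, fun hθ => ?_⟩
  obtain ⟨c, ρ, hc0, hc1, hρ, hb⟩ := exists_geometric_bound hθ0 hθ hA hδ0 hδ hrate
  exact ⟨exists_geometric_bound_dist hθ ha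
    (div_nonneg hC0.le (mul_nonneg ha.le (by linarith))) hδ0 hδ hdec' hc0 hc1 hb
    (hev.mono fun j hj => hj.2), c, ρ, hc0, hc1, hρ, hb⟩

end BregmanFinito

theorem mainTheorem6 {n N : ℕ} (hN : 0 < N)
    (f h : Fin N → E n → EReal) (g : E n → EReal) (L γ : Fin N → ℝ) (θ : ℝ)
    (hbasic : BasicAssumption f h g L γ) (hKL : KLAssumption f h g θ)
    (xinit : E n) (s z zt : ℕ → E n) (I K : ℕ → Finset (Fin N))
    (hrun : IsLowMemoryRun f h g γ xinit s z zt I K) :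
    ∃ x : E n, IsStationaryPt (cost f g) x ∧ Tendsto zt atTop (𝓝 x) ∧
      (1 / 2 < θ → ∃ c : ℝ, 0 < c ∧ ∀ k : ℕ, 1 ≤ k →
        cost f g (zt k) - cost f g x ≤ ((c * (k : ℝ) ^ (-(1 / (2 * θ - 1))) : ℝ) : EReal)) ∧
      (θ ≤ 1 / 2 → RLinearTo zt x ∧
        (∀ k, cost f g (zt k) ≠ ⊥ ∧ cost f g (zt k) ≠ ⊤) ∧
        RLinearTo (fun k => (cost f g (zt k)).toReal) (cost f g x).toReal) := by
  obtain ⟨t, ht, hloc⟩ := hrun.exists_epochs hN hbasic hKL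
  choose j hzt hjk using hloc
  have hbot := cost_ne_bot hbasic hKL
  have hmin := fun k => hrun.isTiltedMin hbasic hKL k
  obtain ⟨x, hstat, hlim, hle, hpoly, hgeo⟩ := exists_limit_of_descent hN hbasic hKL
    (x := fun j => z (t j)) (Y := fun j => table xinit z I (t (j + 1))) (fun j => (hmin (t j)).1)
    (fun j i => (ht j).2.table_mem i) (fun j => hmin (t (j + 1)))
    (fun j => by simpa [(ht (j + 1)).1] using (ht j).2.descent)
  have hfin : ∀ k, cost f g (zt k) ≠ ⊥ ∧ cost f g (zt k) ≠ ⊤ := fun k =>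
    ⟨hbot _, by rw [hzt]; exact (hmin _).1⟩
  have hjlim : Tendsto j atTop atTop := by
    refine tendsto_atTop.2 fun b => ?_
    filter_upwards [eventually_ge_atTop (b * (N + 1))] with k hk
    have h1 : b * (N + 1) < (j k + 1) * (N + 1) := by have := hjk k; omega
    have := lt_of_mul_lt_mul_right h1 (Nat.zero_le _)
    omega
  refine ⟨x, hstat, ?_, fun hθ => ?_, fun hθ => ⟨?_, hfin, ?_⟩⟩
  · rw [funext hzt]
    exact hlim.comp hjlim
  · obtain ⟨c, hc, hb⟩ := hpoly hθ
    set q := 1 / (2 * θ - 1) with hq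
    have hq0 : 0 < q := one_div_pos.2 (by linarith)
    have hN1 : (0 : ℝ) < (N : ℝ) + 1 := by positivity
    refine ⟨c * ((N : ℝ) + 1) ^ q, by positivity, fun k hk => ?_⟩
    rw [← coe_re (hfin k).1 (hfin k).2, ← coe_re hstat.1 hstat.2.1, ← EReal.coe_sub,
      EReal.coe_le_coe_iff, hzt]
    refine (hb (j k)).trans ?_
    rw [mul_assoc]
    refine mul_le_mul_of_nonneg_left ?_ hc.le
    -- after `k` iterations at least `k / (N + 1)` epochs have begun
    have hk0 : (0 : ℝ) < k := by exact_mod_cast hk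
    have h1 : (k : ℝ) / (N + 1) ≤ (j k : ℝ) + 1 := by
      rw [div_le_iff₀ hN1]
      exact_mod_cast (Nat.le_succ k).trans (hjk k)
    calc ((j k : ℝ) + 1) ^ (-q) ≤ ((k : ℝ) / (N + 1)) ^ (-q) :=
          Real.rpow_le_rpow_of_nonpos (by positivity) h1 (by linarith)
      _ = ((N : ℝ) + 1) ^ q * (k : ℝ) ^ (-q) := by
          rw [Real.div_rpow hk0.le hN1.le, Real.rpow_neg hN1.le, div_inv_eq_mul, mul_comm]
  · exact exists_geometric_bound_of_epochs (fun k => by rw [hzt k]) hjk (hgeo hθ).1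
  · refine exists_geometric_bound_of_epochs
      (w := fun j => re (cost f g) (z (t j)) - re (cost f g) x) (fun k => ?_) hjk (hgeo hθ).2
    simp only [Real.dist_eq, hzt k]
    exact abs_of_nonneg (sub_nonneg.2 (hle (j k)))
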